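/- Let $\mathfrak z$ and $\mathfrak v$ be finite-dimensional Euclidean vector spaces, $n=\dim\mathfrak z$, and let $\mathfrak v$ be an orthogonal Clifford module over $\mathfrak z$, i.e. a real module over the Clifford algebra of $\mathfrak z$ with $Z\bullet Z\bullet S=-\|Z\|^2S$ and $\langle Z\bullet S,\tilde S\rangle=-\langle S,Z\bullet\tilde S\rangle$ for all $Z\in\mathfrak z$ and $S,\tilde S\in\mathfrak v$. For $X=X_{\mathfrak z}\oplus X_{\mathfrak v}\in\mathfrak n:=\mathfrak z\oplus\mathfrak v$ with $X_{\mathfrak z}\neq0$ and $X_{\mathfrak v}\neq 0$, let $\check{\mathrm K}(X)\colon\mathfrak z\to\mathfrak z$ be the skew-symmetric operator with $$\langle\check{\mathrm K}(X)Z_1,Z_2\rangle=\frac{\langle Z_1\bullet X_{\mathfrak z}\bullet X_{\mathfrak v},\,Z_2\bullet X_{\mathfrak v}\rangle}{\|X_{\mathfrak z}\|\,\|X_{\mathfrak v}\|^2}\qquad(Z_1,Z_2\in\mathfrak z).$$ Let $\mathfrak n\setminus\mathrm{ram}(\check{\mathrm K}^2)$ be the open set of all $X$ with $X_{\mathfrak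 z}\ne0$, $X_{\mathfrak v}\neq0$ near which the multiplicities of the eigenvalues of the nonnegative self-adjoint operators $-\check{\mathrm K}^2$ are constant. An eigenvalue branch of $-\check{\mathrm K}^2$ is a real-analytic function $\check\mu\colon U\to\mathbb R$ on a connected component $U$ of $\mathfrak n\setminus\mathrm{ram}(\check{\mathrm K}^2)$ such that $\check\mu(X)$ is an eigenvalue of $-\check{\mathrm K}(X)^2$ for every $X\in U$; it is nonzero if it is not identically zero on $U$. Suppose that $n\ge 6$ and $\dim\mathfrak v>8n-28$. Then every nonzero eigenvalue branch $\check\mu\colon U\to\mathbb R$ of $-\check{\mathrm K}^2$ has multiplicity $2$, that is, the eigenspace of $-\check{\mathrm K}(X)^2$ for the eigenvalue $\check\mu(X)$ has dimension $2$ for every $X\in U$. -/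

import Mathlib

open Module Topology
open scoped RealInnerProductSpace

noncomputable section

namespace HType

/-- The negative definite quadratic form `Z ↦ -‖Z‖ ^ 2` of a Euclidean vector space `𝔷`. -/
def negNormSq (𝔷 : Type*) [NormedAddCommGroup 𝔷] [InnerProductSpace ℝ 𝔷] : QuadraticForm ℝ 𝔷 :=
  -(LinearMap.BilinMap.toQuadraticMap (innerₗ 𝔷))

theorem negNormSq_apply {𝔷 : Type*} [NormedAddCommGroup 𝔷] [InnerProductSpace ℝ 𝔷] (Z : 𝔷) :
    negNormSq 𝔷 Z = -‖Z‖ ^ 2 := by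
  simp [negNormSq]

/-- An orthogonal Clifford module structure on the Euclidean vector space `𝔳` over the Euclidean
vector space `𝔷`: a real representation of the Clifford algebra of `𝔷` (with the convention
`Z * Z = -‖Z‖ ^ 2`) in which every `Z ∈ 𝔷` acts by a skew-symmetric endomorphism. -/
structure OrthogonalCliffordModule (𝔷 𝔳 : Type*) [NormedAddCommGroup 𝔷] [InnerProductSpace ℝ 𝔷]
    [NormedAddCommGroup 𝔳] [InnerProductSpace ℝ 𝔳] where
  /-- the action of the Clifford algebra -/
  action : CliffordAlgebra (negNormSq 𝔷) →ₐ[ℝ] Module.End ℝ 𝔳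
  skew : ∀ (Z : 𝔷) (S S' : 𝔳),
    ⟪action (CliffordAlgebra.ι (negNormSq 𝔷) Z) S, S'⟫
      = -⟪S, action (CliffordAlgebra.ι (negNormSq 𝔷) Z) S'⟫

namespace OrthogonalCliffordModule

variable {𝔷 𝔳 : Type*} [NormedAddCommGroup 𝔷] [InnerProductSpace ℝ 𝔷]
  [NormedAddCommGroup 𝔳] [InnerProductSpace ℝ 𝔳] (c : OrthogonalCliffordModule 𝔷 𝔳)

/-- Clifford multiplication `Z ↦ (S ↦ Z • S)`. -/
def mul : 𝔷 →ₗ[ℝ] 𝔳 →ₗ[ℝ] 𝔳 :=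
  c.action.toLinearMap ∘ₗ CliffordAlgebra.ι (negNormSq 𝔷)

theorem inner_mul_left (Z : 𝔷) (S S' : 𝔳) : ⟪c.mul Z S, S'⟫ = -⟪S, c.mul Z S'⟫ :=
  c.skew Z S S'

theorem mul_mul_self (Z : 𝔷) (S : 𝔳) : c.mul Z (c.mul Z S) = -(‖Z‖ ^ 2 • S) := by
  have h := congrArg c.action (CliffordAlgebra.ι_sq_scalar (negNormSq 𝔷) Z)
  rw [map_mul, AlgHom.commutes, negNormSq_apply] at h
  have h' := LinearMap.congr_fun h S
  rw [Module.End.mul_apply, Module.algebraMap_end_apply, neg_smul] at h'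
  exact h'

variable [FiniteDimensional ℝ 𝔷] [FiniteDimensional ℝ 𝔳]

/-- The alternating spinor product `𝔳 × 𝔳 → 𝔷`, adjoint to Clifford multiplication. -/
def spinorProduct (S : 𝔳) : 𝔳 →ₗ[ℝ] 𝔷 :=
  LinearMap.adjoint (c.mul.flip S)

theorem inner_spinorProduct (Z : 𝔷) (S S' : 𝔳) :
    ⟪Z, c.spinorProduct S S'⟫ = ⟪c.mul Z S, S'⟫ := by
  simp [spinorProduct, LinearMap.adjoint_inner_right]

/-- The operator on `𝔷` attached to `X = (X_𝔷, X_𝔳) ∈ 𝔷 ⊕ 𝔳`, given by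
`Z ↦ X_𝔳 * (Z • X_𝔷 • X_𝔳)`, where `*` is the spinor product and `•` is Clifford
multiplication; `inner_hatK` is its characterization. -/
def hatK (X : 𝔷 × 𝔳) : 𝔷 →ₗ[ℝ] 𝔷 :=
  c.spinorProduct X.2 ∘ₗ c.mul.flip (c.mul X.1 X.2)

theorem inner_hatK (X : 𝔷 × 𝔳) (Z₁ Z₂ : 𝔷) :
    ⟪c.hatK X Z₁, Z₂⟫ = ⟪c.mul Z₁ (c.mul X.1 X.2), c.mul Z₂ X.2⟫ := by
  rw [real_inner_comm, hatK, LinearMap.comp_apply, inner_spinorProduct, real_inner_comm,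
    LinearMap.flip_apply]

/-- The rescaled operator, meaningful when `X.1 ≠ 0` and `X.2 ≠ 0`. -/
def checkK (X : 𝔷 × 𝔳) : 𝔷 →ₗ[ℝ] 𝔷 :=
  (‖X.1‖ * ‖X.2‖ ^ 2)⁻¹ • c.hatK X

/-- The nonnegative self-adjoint operator `-checkK X ^ 2`. -/
def negCheckKSq (X : 𝔷 × 𝔳) : Module.End ℝ 𝔷 :=
  -(c.checkK X ∘ₗ c.checkK X)

/-- The multiplicity of the real number `t` as an eigenvalue of `-checkK X ^ 2` (it is zero if `t`
is not an eigenvalue). -/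
def multiplicity (X : 𝔷 × 𝔳) (t : ℝ) : ℕ :=
  finrank ℝ (End.eigenspace (c.negCheckKSq X) t)

/-- The number of distinct eigenvalues of `-checkK X ^ 2` that have multiplicity exactly `k`.
For `k = 1, 2, …` these numbers record the eigenvalue multiplicities of `-checkK X ^ 2`. -/
def numEigenvalues (X : 𝔷 × 𝔳) (k : ℕ) : ℕ :=
  Set.ncard {t : ℝ | c.multiplicity X t = k}

/-- The points with both components nonzero, on which `checkK` is defined. -/
def domain (𝔷 𝔳 : Type*) [NormedAddCommGroup 𝔷] [NormedAddCommGroup 𝔳] : Set (𝔷 × 𝔳) :=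
  {X | X.1 ≠ 0 ∧ X.2 ≠ 0}

/-- The ramification locus of the family `-checkK ^ 2`. Its complement consists of the points of
the domain near which the eigenvalue multiplicities are constant; this is the largest open
subset of the domain on each of whose connected components they are constant. -/
def ramificationLocus : Set (𝔷 × 𝔳) :=
  {X | X ∈ domain 𝔷 𝔳 ∧
    ∀ᶠ Y in 𝓝 X, ∀ k : ℕ, 0 < k → c.numEigenvalues Y k = c.numEigenvalues X k}ᶜ

/-- An eigenvalue branch of the family `-checkK ^ 2` on `U`: a real-analytic function on `U` whose
value at every `X ∈ U` is an eigenvalue of `-checkK X ^ 2`. -/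
structure IsEigenvalueBranch (U : Set (𝔷 × 𝔳)) (μ : 𝔷 × 𝔳 → ℝ) : Prop where
  analytic : AnalyticOnNhd ℝ μ U
  hasEigenvalue : ∀ X ∈ U, End.HasEigenvalue (c.negCheckKSq X) (μ X)

end OrthogonalCliffordModule

end HType

end

/-!
Write `K = checkK X`. At a point `X = (Z, S)` off the ramification locus, where a nonzero eigenvalue
of `-K ^ 2` does not split under small perturbations, first order perturbation theory says that the
derivative of `‖hatK A‖ ^ 2` in the direction of any spinor `T` is the same for all unit vectors `A`
of the eigenspace (`inner_hatK_hatKDeriv_eq`). Writing `I` for the complex structure on the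
eigenspace obtained from `K`, this derivative is a fixed multiple of the inner product of
`I A • A • Z • S` and `T`, so the vector `I A • A • Z • S` does not depend on `A`. If the
multiplicity is at least `3`, there is a unit vector `B` in the eigenspace orthogonal to `A` and
`I A`, and comparing `A` with `B` shows that `A • I A • I B • B` fixes `S`: the spinor is fixed by
the Clifford volume element of an orthonormal quadruple in the complement of `Z`
(`exists_isFixingFrame`).

Such spinors are rare. Rotating the quadruple within its span does not change its volume element, so
the quadruple may be taken in echelon form with respect to a flag in the complement of `Z`. These
quadruples lie in finitely many charts of dimension `4 n - 14`, where `n = dim 𝔷`. A volume element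
anticommutes with Clifford multiplication by each of its factors, so its fixed space has half the
dimension of `𝔳`. Hence the exceptional spinors form a set of Hausdorff dimension at most
`4 n - 14 + dim 𝔳 / 2 < dim 𝔳`, and their complement is dense
(`dense_setOf_not_isFixingFrame`).

So arbitrarily near each point off the ramification locus all nonzero eigenvalues are double. As
the numbers of eigenvalues of given multiplicity are locally constant and the dimension of the
kernel is upper semicontinuous, this carries over to the point itself (`multiplicity_eq_two`). It
follows that the dimension of the kernel is locally constant, so that the zero set of an eigenvalue
branch is open and closed in its connected domain; a nonzero branch therefore vanishes nowhere
(`IsEigenvalueBranch.ne_zero`).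
-/

noncomputable section

namespace HType

/-! ### Symmetric operators -/

section Spectral

variable {E : Type*} [NormedAddCommGroup E] [InnerProductSpace ℝ E] {T : E →ₗ[ℝ] E}

theorem inner_eigenspace_eq_zero (hT : T.IsSymmetric) {s t : ℝ} (hst : s ≠ t) {v w : E}
    (hv : v ∈ End.eigenspace T s) (hw : w ∈ End.eigenspace T t) : ⟪v, w⟫ = 0 := by
  rw [End.mem_eigenspace_iff] at hv hw
  have h := hT v w
  rw [hv, hw, real_inner_smul_left, real_inner_smul_right] at h
  have h' : (s - t) * ⟪v, w⟫ = 0 := by linarith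
  exact (mul_eq_zero.mp h').resolve_left (sub_ne_zero.mpr hst)

variable [FiniteDimensional ℝ E]

theorem norm_sq_apply_sub_smul (hT : T.IsSymmetric) (u : ℝ) (v : E) :
    ‖T v - u • v‖ ^ 2 =
      ∑ i, (hT.eigenvalues rfl i - u) ^ 2 * ((hT.eigenvectorBasis rfl).repr v i) ^ 2 := by
  rw [← (hT.eigenvectorBasis rfl).repr.norm_map, EuclideanSpace.norm_sq_eq]
  refine Finset.sum_congr rfl fun i _ => ?_
  rw [map_sub, map_smul, PiLp.sub_apply, PiLp.smul_apply, hT.eigenvectorBasis_apply_self_apply,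
    Real.norm_eq_abs, sq_abs, smul_eq_mul, RCLike.ofReal_real_eq_id, id]
  ring

theorem inner_apply_self_sub (hT : T.IsSymmetric) (t : ℝ) (v : E) :
    ⟪T v, v⟫ - t * ‖v‖ ^ 2 =
      ∑ i, (hT.eigenvalues rfl i - t) * ((hT.eigenvectorBasis rfl).repr v i) ^ 2 := by
  rw [← real_inner_self_eq_norm_sq, ← real_inner_smul_left, ← inner_sub_left,
    ← (hT.eigenvectorBasis rfl).repr.inner_map_map, PiLp.inner_apply]
  refine Finset.sum_congr rfl fun i _ => ?_
  rw [map_sub, map_smul, PiLp.sub_apply, PiLp.smul_apply, hT.eigenvectorBasis_apply_self_apply,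
    smul_eq_mul, RCLike.ofReal_real_eq_id, id, real_inner_eq_re_inner, RCLike.inner_apply]
  simp only [conj_trivial, RCLike.re_to_real]
  ring

/-- An approximate eigenvector of a symmetric operator forces a true eigenvalue nearby. -/
theorem exists_hasEigenvalue_near (hT : T.IsSymmetric) {u δ : ℝ} {v : E}
    (h : ‖T v - u • v‖ < δ * ‖v‖) : ∃ t, End.HasEigenvalue T t ∧ |t - u| < δ := by
  by_contra! hc
  have hδ : 0 < δ := by
    by_contra! hδ
    nlinarith [norm_nonneg (T v - u • v), norm_nonneg v]
  have h1 : (δ * ‖v‖) ^ 2 ≤ ‖T v - u • v‖ ^ 2 := by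
    rw [norm_sq_apply_sub_smul hT, mul_pow, ← (hT.eigenvectorBasis rfl).repr.norm_map v,
      EuclideanSpace.norm_sq_eq, Finset.mul_sum]
    refine Finset.sum_le_sum fun i _ => ?_
    rw [Real.norm_eq_abs, sq_abs]
    refine mul_le_mul_of_nonneg_right ?_ (sq_nonneg _)
    rw [← sq_abs (_ - u)]
    exact pow_le_pow_left₀ hδ.le (hc _ (hT.hasEigenvalue_eigenvalues rfl i)) 2
  exact absurd (pow_lt_pow_left₀ h (norm_nonneg _) two_ne_zero) (not_lt.mpr h1)

/-- If `t` is the only eigenvalue of `T` in the `δ`-neighbourhood of `t₀`, then the quadratic form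
of `T - t` is of second order on vectors that are almost eigenvectors for `t₀`. -/
theorem abs_inner_apply_self_sub_le (hT : T.IsSymmetric) {t t₀ δ : ℝ} (hδ : 0 < δ)
    (ht : |t - t₀| ≤ δ) (hsep : ∀ x, End.HasEigenvalue T x → x = t ∨ δ ≤ |x - t₀|) (v : E) :
    |⟪T v, v⟫ - t * ‖v‖ ^ 2| ≤ 2 / δ * ‖T v - t₀ • v‖ ^ 2 := by
  rw [norm_sq_apply_sub_smul hT, inner_apply_self_sub hT, Finset.mul_sum]
  refine (Finset.abs_sum_le_sum_abs _ _).trans (Finset.sum_le_sum fun i _ => ?_)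
  rw [abs_mul, abs_of_nonneg (sq_nonneg ((hT.eigenvectorBasis rfl).repr v i)), ← mul_assoc]
  refine mul_le_mul_of_nonneg_right ?_ (sq_nonneg _)
  set x := hT.eigenvalues rfl i
  rcases hsep x (hT.hasEigenvalue_eigenvalues rfl i) with h | h
  · rw [h, sub_self, abs_zero]
    positivity
  · have h1 : |x - t| ≤ |x - t₀| + |t - t₀| := by
      rw [abs_sub_comm t]
      exact abs_sub_le x t₀ t
    rw [div_mul_eq_mul_div, le_div_iff₀ hδ, ← sq_abs (x - t₀)]
    nlinarith [abs_nonneg (x - t)]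

/-- An operator is bounded below on the orthogonal complement of its kernel. -/
theorem exists_le_norm_apply_of_mem_orthogonal (T : E →ₗ[ℝ] E) :
    ∃ δ > 0, ∀ w ∈ (LinearMap.ker T)ᗮ, δ * ‖w‖ ≤ ‖T w‖ := by
  have hker : LinearMap.ker (T ∘ₗ (LinearMap.ker T)ᗮ.subtype) = ⊥ := by
    rw [LinearMap.ker_eq_bot']
    intro w hw
    have h0 : (w : E) = 0 :=
      (Submodule.disjoint_def.mp (Submodule.orthogonal_disjoint (LinearMap.ker T))) w hw w.2
    exact_mod_cast h0
  obtain ⟨K, hK, hanti⟩ := LinearMap.exists_antilipschitzWith _ hker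
  refine ⟨(K : ℝ)⁻¹, by positivity, fun w hw => ?_⟩
  have h := hanti.le_mul_dist ⟨w, hw⟩ 0
  rw [map_zero, dist_zero_right, dist_zero_right] at h
  rw [inv_mul_le_iff₀ (by exact_mod_cast hK)]
  exact h

end Spectral

namespace OrthogonalCliffordModule

/-! ### The operators `hatK`, `checkK` and `negCheckKSq` -/

variable {𝔷 𝔳 : Type*} [NormedAddCommGroup 𝔷] [InnerProductSpace ℝ 𝔷]
  [NormedAddCommGroup 𝔳] [InnerProductSpace ℝ 𝔳] (c : OrthogonalCliffordModule 𝔷 𝔳)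

/-- The polarized Clifford relation. -/
theorem mul_mul_add_mul_mul (A B : 𝔷) (S : 𝔳) :
    c.mul A (c.mul B S) + c.mul B (c.mul A S) = -((2 * ⟪A, B⟫) • S) := by
  have h := c.mul_mul_self (A + B) S
  have hA := c.mul_mul_self A S
  have hB := c.mul_mul_self B S
  simp only [map_add, LinearMap.add_apply] at h
  rw [hA, hB, @norm_add_sq_real] at h
  have h2 : c.mul A (c.mul B S) + c.mul B (c.mul A S)
      = -((‖A‖ ^ 2 + 2 * ⟪A, B⟫ + ‖B‖ ^ 2) • S) + ‖A‖ ^ 2 • S + ‖B‖ ^ 2 • S := by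
    rw [← h]; abel
  rw [h2]
  module

theorem mul_anticomm {A B : 𝔷} (h : ⟪A, B⟫ = 0) (S : 𝔳) :
    c.mul A (c.mul B S) = -c.mul B (c.mul A S) := by
  have h' := c.mul_mul_add_mul_mul A B S
  rw [h, mul_zero, zero_smul, neg_zero] at h'
  exact eq_neg_of_add_eq_zero_left h'

theorem mul_mul_self_of_norm_eq_one {A : 𝔷} (h : ‖A‖ = 1) (S : 𝔳) :
    c.mul A (c.mul A S) = -S := by
  rw [c.mul_mul_self, h]; simp

theorem mul_injective {Z : 𝔷} (hZ : Z ≠ 0) : Function.Injective (c.mul Z) := by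
  rw [injective_iff_map_eq_zero]
  intro S hS
  have h := c.mul_mul_self Z S
  rw [hS, map_zero, eq_comm, neg_eq_zero, smul_eq_zero] at h
  exact h.resolve_left (by simpa using hZ)

variable [FiniteDimensional ℝ 𝔷] [FiniteDimensional ℝ 𝔳]

theorem inner_hatK_left (X : 𝔷 × 𝔳) (A B : 𝔷) : ⟪c.hatK X A, B⟫ = -⟪A, c.hatK X B⟫ := by
  rw [real_inner_comm (c.hatK X B), c.inner_hatK, c.inner_hatK, real_inner_comm (c.mul A X.2)]
  have h1 := c.inner_mul_left B X.2 (c.mul A (c.mul X.1 X.2))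
  have h2 := c.inner_mul_left A X.2 (c.mul B (c.mul X.1 X.2))
  have h3 := congrArg (fun V => ⟪X.2, V⟫) (c.mul_mul_add_mul_mul A B (c.mul X.1 X.2))
  have h4 := c.inner_mul_left X.1 X.2 X.2
  rw [real_inner_comm] at h4
  have h5 : ⟪X.2, c.mul X.1 X.2⟫ = 0 := by linarith
  simp only [inner_add_right, inner_neg_right, real_inner_smul_right, h5] at h3
  rw [real_inner_comm (c.mul B X.2), h1, h2]
  linarith

theorem hatK_self (X : 𝔷 × 𝔳) : c.hatK X X.1 = 0 := by
  refine ext_inner_right ℝ fun B => ?_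
  rw [c.inner_hatK, c.mul_mul_self, inner_zero_left, inner_neg_left, real_inner_smul_left]
  have h4 := c.inner_mul_left B X.2 X.2
  rw [real_inner_comm] at h4
  have h5 : ⟪X.2, c.mul B X.2⟫ = 0 := by linarith
  rw [h5]; ring

theorem inner_checkK_left (X : 𝔷 × 𝔳) (A B : 𝔷) : ⟪c.checkK X A, B⟫ = -⟪A, c.checkK X B⟫ := by
  simp only [checkK, LinearMap.smul_apply, real_inner_smul_left, real_inner_smul_right,
    c.inner_hatK_left]
  ring

theorem inner_checkK_self (X : 𝔷 × 𝔳) (A : 𝔷) : ⟪c.checkK X A, A⟫ = 0 := by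
  have h := c.inner_checkK_left X A A
  rw [real_inner_comm (c.checkK X A)] at h
  linarith

theorem inner_negCheckKSq (X : 𝔷 × 𝔳) (A B : 𝔷) :
    ⟪c.negCheckKSq X A, B⟫ = ⟪c.checkK X A, c.checkK X B⟫ := by
  simp [negCheckKSq, c.inner_checkK_left]

theorem negCheckKSq_isSymmetric (X : 𝔷 × 𝔳) : (c.negCheckKSq X).IsSymmetric := by
  intro A B
  rw [c.inner_negCheckKSq, ← real_inner_comm, ← c.inner_negCheckKSq, real_inner_comm]

theorem fst_mem_eigenspace_zero (X : 𝔷 × 𝔳) : X.1 ∈ End.eigenspace (c.negCheckKSq X) 0 := by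
  rw [End.mem_eigenspace_iff]
  simp [negCheckKSq, checkK, c.hatK_self]

theorem eigenspace_zero (X : 𝔷 × 𝔳) :
    End.eigenspace (c.negCheckKSq X) 0 = LinearMap.ker (c.negCheckKSq X) :=
  End.eigenspace_zero _

theorem multiplicity_pos_iff (X : 𝔷 × 𝔳) (t : ℝ) :
    0 < c.multiplicity X t ↔ End.HasEigenvalue (c.negCheckKSq X) t := by
  rw [multiplicity, End.hasEigenvalue_iff, pos_iff_ne_zero, Ne, Submodule.finrank_eq_zero]

/-- The operator `checkK X` maps each eigenspace of `negCheckKSq X` to itself. -/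
theorem checkK_mem_eigenspace {X : 𝔷 × 𝔳} {t : ℝ} {A : 𝔷}
    (hA : A ∈ End.eigenspace (c.negCheckKSq X) t) :
    c.checkK X A ∈ End.eigenspace (c.negCheckKSq X) t := by
  rw [End.mem_eigenspace_iff] at hA ⊢
  rw [← map_smul, ← hA]
  simp [negCheckKSq]

theorem norm_checkK_sq {X : 𝔷 × 𝔳} {t : ℝ} {A : 𝔷}
    (hA : A ∈ End.eigenspace (c.negCheckKSq X) t) : ‖c.checkK X A‖ ^ 2 = t * ‖A‖ ^ 2 := by
  rw [← real_inner_self_eq_norm_sq, ← c.inner_negCheckKSq, End.mem_eigenspace_iff.mp hA,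
    real_inner_smul_left, real_inner_self_eq_norm_sq]

theorem two_le_multiplicity {X : 𝔷 × 𝔳} {t : ℝ} (ht : t ≠ 0)
    (h : 0 < c.multiplicity X t) : 2 ≤ c.multiplicity X t := by
  by_contra! hlt
  have h1 : finrank ℝ (End.eigenspace (c.negCheckKSq X) t) = 1 := by
    unfold multiplicity at h hlt
    omega
  obtain ⟨⟨A, hA⟩, hA0, hspan⟩ := finrank_eq_one_iff'.mp h1
  obtain ⟨a, ha⟩ := hspan ⟨_, c.checkK_mem_eigenspace hA⟩
  have ha' : a • A = c.checkK X A := congrArg Subtype.val ha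
  have hA0' : A ≠ 0 := fun h => hA0 (Subtype.ext h)
  have h2 := c.inner_checkK_self X A
  have h3 := c.norm_checkK_sq hA
  have hn : 0 < ‖A‖ ^ 2 := by positivity
  rw [← ha', real_inner_smul_left, real_inner_self_eq_norm_sq] at h2
  rw [← ha', (mul_eq_zero.mp h2).resolve_right hn.ne', zero_smul, norm_zero] at h3
  exact ht ((mul_eq_zero.mp (by linarith : t * ‖A‖ ^ 2 = 0)).resolve_right hn.ne')

/-! ### Continuity -/

theorem continuous_mul : Continuous fun p : 𝔷 × 𝔳 => c.mul p.1 p.2 :=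
  (LinearMap.toContinuousBilinearMap c.mul).continuous₂

theorem continuous_hatK_apply (A : 𝔷) : Continuous fun X : 𝔷 × 𝔳 => c.hatK X A := by
  have h : (fun X : 𝔷 × 𝔳 => c.hatK X A) = fun X : 𝔷 × 𝔳 =>
      ∑ i, ⟪c.mul A (c.mul X.1 X.2), c.mul (stdOrthonormalBasis ℝ 𝔷 i) X.2⟫ •
        stdOrthonormalBasis ℝ 𝔷 i := by
    funext X
    rw [← (stdOrthonormalBasis ℝ 𝔷).sum_repr' (c.hatK X A)]
    refine Finset.sum_congr rfl fun i _ => ?_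
    rw [real_inner_comm, c.inner_hatK]
  rw [h]
  have hm : ∀ (B : 𝔷), Continuous fun S : 𝔳 => c.mul B S := fun B =>
    (c.mul B).continuous_of_finiteDimensional
  have h2 : ∀ B : 𝔷, Continuous fun X : 𝔷 × 𝔳 => c.mul B X.2 := fun B =>
    (hm B).comp continuous_snd
  have h3 : Continuous fun X : 𝔷 × 𝔳 => c.mul A (c.mul X.1 X.2) := (hm A).comp c.continuous_mul
  exact continuous_finsetSum _ fun i _ => (h3.inner (h2 _)).smul continuous_const

theorem continuousAt_negCheckKSq {X : 𝔷 × 𝔳} (hX : X ∈ domain 𝔷 𝔳) :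
    ContinuousAt (fun Y => LinearMap.toContinuousLinearMap (c.negCheckKSq Y)) X := by
  have h : ContinuousAt (fun Y => LinearMap.toContinuousLinearMap (c.checkK Y)) X := by
    rw [continuousAt_clm_apply]
    intro A
    refine ContinuousAt.smul (ContinuousAt.inv₀ ?_ ?_) (c.continuous_hatK_apply A).continuousAt
    · fun_prop
    · have h1 := norm_ne_zero_iff.mpr hX.1
      have h2 := norm_ne_zero_iff.mpr hX.2
      positivity
  exact (h.clm_comp h).neg

theorem isOpen_domain (𝔷 𝔳 : Type*) [NormedAddCommGroup 𝔷] [NormedAddCommGroup 𝔳] :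
    IsOpen (domain 𝔷 𝔳) :=
  (isOpen_ne_fun continuous_fst continuous_const).inter
    (isOpen_ne_fun continuous_snd continuous_const)

/-- An eigenvalue that tends to zero without being zero makes the kernel jump. -/
theorem eventually_multiplicity_add_le {X : 𝔷 × 𝔳} (hX : X ∈ domain 𝔷 𝔳) :
    ∃ ε > 0, ∀ᶠ Y in 𝓝 X, ∀ t : ℝ, t ≠ 0 → |t| < ε →
      c.multiplicity Y 0 + c.multiplicity Y t ≤ c.multiplicity X 0 := by
  obtain ⟨δ, hδ, hlow⟩ := exists_le_norm_apply_of_mem_orthogonal (c.negCheckKSq X)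
  refine ⟨δ / 2, by positivity, ?_⟩
  filter_upwards [(c.continuousAt_negCheckKSq hX).eventually
    (Metric.ball_mem_nhds _ (by positivity : 0 < δ / 2))] with Y hY t ht0 ht
  have hsym := c.negCheckKSq_isSymmetric Y
  set E₀ := End.eigenspace (c.negCheckKSq Y) 0
  set E₁ := End.eigenspace (c.negCheckKSq Y) t
  set M := LinearMap.ker (c.negCheckKSq X)
  have hdisj : Disjoint E₀ E₁ := by
    rw [Submodule.disjoint_def]
    intro v h0 h1
    exact inner_self_eq_zero.mp (inner_eigenspace_eq_zero hsym ht0.symm h0 h1)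
  have hsum := Submodule.finrank_sup_add_finrank_inf_eq E₀ E₁
  rw [hdisj.eq_bot, finrank_bot, add_zero] at hsum
  -- the form is too small on `E₀ ⊔ E₁` for this space to meet the complement of the kernel
  have hdisj' : Disjoint (E₀ ⊔ E₁) Mᗮ := by
    rw [Submodule.disjoint_def]
    intro v hv hvM
    obtain ⟨a, ha, b, hb, rfl⟩ := Submodule.mem_sup.mp hv
    by_contra hne
    have hab := inner_eigenspace_eq_zero hsym ht0.symm ha hb
    have hpyth : ‖b‖ ≤ ‖a + b‖ := by
      have h := @norm_add_sq_real 𝔷 _ _ a b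
      rw [hab] at h
      exact (sq_le_sq₀ (norm_nonneg _) (norm_nonneg _)).mp (by nlinarith [sq_nonneg ‖a‖])
    have h1 : c.negCheckKSq Y (a + b) = t • b := by
      rw [map_add, End.mem_eigenspace_iff.mp ha, End.mem_eigenspace_iff.mp hb]; simp
    have h2 := hlow _ hvM
    have h3 : ‖c.negCheckKSq Y (a + b) - c.negCheckKSq X (a + b)‖ ≤ δ / 2 * ‖a + b‖ := by
      have h := ContinuousLinearMap.le_of_opNorm_le _ (mem_ball_iff_norm.mp hY).le (a + b)
      simpa using h
    have h4 := norm_sub_norm_le (c.negCheckKSq X (a + b)) (c.negCheckKSq Y (a + b))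
    rw [norm_sub_rev, h1, norm_smul, Real.norm_eq_abs] at h4
    rw [h1] at h3
    have hpos : 0 < ‖a + b‖ := norm_pos_iff.mpr hne
    have h5 : |t| * ‖b‖ ≤ |t| * ‖a + b‖ := mul_le_mul_of_nonneg_left hpyth (abs_nonneg t)
    have h6 : |t| * ‖a + b‖ < δ / 2 * ‖a + b‖ := mul_lt_mul_of_pos_right ht hpos
    linarith
  have hle := Submodule.finrank_add_finrank_le_of_disjoint hdisj'
  have hM := M.finrank_add_finrank_orthogonal
  have hX0 : c.multiplicity X 0 = finrank ℝ M := by rw [multiplicity, c.eigenspace_zero]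
  have hY0 : c.multiplicity Y 0 = finrank ℝ E₀ := rfl
  have hYt : c.multiplicity Y t = finrank ℝ E₁ := rfl
  omega

end OrthogonalCliffordModule

/-! ### Charts and coordinate subspaces -/

section Covering

/-- A hyperplane of a nonzero subspace, cut out by a vector. -/
theorem exists_hyperplane {E : Type*} [NormedAddCommGroup E] [InnerProductSpace ℝ E]
    [FiniteDimensional ℝ E] (W : Submodule ℝ E) {m : ℕ} (hW : finrank ℝ W = m + 1) :
    ∃ (l : E) (W' : Submodule ℝ E), finrank ℝ W' = m ∧ ∀ w ∈ W, ⟪l, w⟫ = 0 → w ∈ W' := by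
  obtain ⟨l, hl, hl0⟩ := W.exists_mem_ne_zero_of_ne_bot (by rintro rfl; simp at hW)
  refine ⟨l, (ℝ ∙ l)ᗮ ⊓ W, ?_, fun w hw h =>
    ⟨Submodule.mem_orthogonal_singleton_iff_inner_right.mpr h, hw⟩⟩
  have h := Submodule.finrank_add_inf_finrank_orthogonal
    (K₁ := ℝ ∙ l) (K₂ := W) (by rwa [Submodule.span_singleton_le_iff_mem])
  rw [finrank_span_singleton hl0] at h
  omega

/-- The affine charts of the projective space of `W`: finitely many affine subspaces of dimension
one less than `W`, avoiding the origin, meet every line of `W`. -/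
theorem exists_affine_charts {E : Type*} [NormedAddCommGroup E] [InnerProductSpace ℝ E]
    [FiniteDimensional ℝ E] (W : Submodule ℝ E) {m : ℕ} (hW : finrank ℝ W = m + 1) :
    ∃ (f : Fin (m + 1) → E) (g : Fin (m + 1) → EuclideanSpace ℝ (Fin m) →ₗ[ℝ] E),
      (∀ j x, f j + g j x ≠ 0) ∧ ∀ w ∈ W, w ≠ 0 → ∃ j x, ∃ a : ℝ, w = a • (f j + g j x) := by
  let b := (stdOrthonormalBasis ℝ W).reindex (finCongr hW)
  have hfin : ∀ j, finrank ℝ ((ℝ ∙ b j)ᗮ : Submodule ℝ W) = m := fun j => by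
    have : Fact (finrank ℝ W = m + 1) := ⟨hW⟩
    exact Submodule.finrank_orthogonal_span_singleton (b.orthonormal.ne_zero j)
  let e : ∀ j, EuclideanSpace ℝ (Fin m) ≃ₗ[ℝ] ((ℝ ∙ b j)ᗮ : Submodule ℝ W) := fun j =>
    LinearEquiv.ofFinrankEq _ _ (by rw [hfin j, finrank_euclideanSpace_fin])
  have hbb : ∀ j, ⟪b j, b j⟫ = 1 := fun j => by
    rw [real_inner_self_eq_norm_sq, b.orthonormal.1 j, one_pow]
  refine ⟨fun j => (b j : E), fun j => W.subtype ∘ₗ (Submodule.subtype _) ∘ₗ (e j).toLinearMap,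
    fun j x h => ?_, fun w hw hw0 => ?_⟩
  · have h0 : b j + (e j x : W) = 0 := Subtype.ext (by simpa using h)
    have h1 := congrArg (fun v => ⟪b j, v⟫) h0
    have h2 := Submodule.mem_orthogonal_singleton_iff_inner_right.mp (e j x).2
    simp only [inner_add_right, h2, hbb, inner_zero_right] at h1
    norm_num at h1
  · have hex : ∃ j, ⟪b j, (⟨w, hw⟩ : W)⟫ ≠ 0 := by
      by_contra! hall
      have h := b.sum_repr' (⟨w, hw⟩ : W)
      simp only [hall, zero_smul, Finset.sum_const_zero] at h
      exact hw0 (congrArg Subtype.val h).symm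
    obtain ⟨j, hj⟩ := hex
    set a := ⟪b j, (⟨w, hw⟩ : W)⟫
    have hmem : a⁻¹ • (⟨w, hw⟩ : W) - b j ∈ (ℝ ∙ b j)ᗮ := by
      rw [Submodule.mem_orthogonal_singleton_iff_inner_right, inner_sub_right,
        real_inner_smul_right, hbb, inv_mul_cancel₀ hj, sub_self]
    refine ⟨j, (e j).symm ⟨_, hmem⟩, a, ?_⟩
    simp [smul_smul, mul_inv_cancel₀ hj]

/-- Finitely many coordinate subspaces of dimension `r` suffice to hit the whole range of every
operator of rank `r`. -/
theorem exists_coordinates_of_mem_range {V ι : Type*} [AddCommGroup V] [Module ℝ V]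
    [FiniteDimensional ℝ V] [Finite ι] (b : Basis ι ℝ V) (F : V →ₗ[ℝ] V) {r : ℕ}
    (hr : finrank ℝ (LinearMap.range F) = r) :
    ∃ κ : Fin r → ι, ∀ S ∈ LinearMap.range F, ∃ t : EuclideanSpace ℝ (Fin r),
      F (∑ i, t i • b (κ i)) = S := by
  obtain ⟨κ', a, ha, hspan, hli⟩ := exists_linearIndependent' ℝ (F ∘ b)
  have : Finite κ' := Finite.of_injective a ha
  have := Fintype.ofFinite κ'
  have hrange : Submodule.span ℝ (Set.range ((F ∘ b) ∘ a)) = LinearMap.range F := by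
    rw [hspan, Set.range_comp, Submodule.span_image, b.span_eq, LinearMap.range_eq_map]
  have hcard : Fintype.card κ' = r := by
    rw [← hr, ← hrange, finrank_span_eq_card hli]
  let e := (Fintype.equivFinOfCardEq hcard)
  refine ⟨fun i => a (e.symm i), fun S hS => ?_⟩
  rw [← hrange, Submodule.mem_span_range_iff_exists_fun] at hS
  obtain ⟨t, ht⟩ := hS
  refine ⟨WithLp.toLp 2 fun i => t (e.symm i), ?_⟩
  rw [map_sum, ← ht]
  simp only [map_smul]
  exact Equiv.sum_comp e.symm fun i => t i • F (b (a i))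

/-- An involution that anticommutes with an injective operator has equally large eigenspaces. -/
theorem finrank_range_id_add {V : Type*} [AddCommGroup V] [Module ℝ V] [FiniteDimensional ℝ V]
    {ω J : V →ₗ[ℝ] V} (hω : ∀ S, ω (ω S) = S) (hJ : Function.Injective J)
    (hJω : ∀ S, J (ω S) = -ω (J S)) :
    2 * finrank ℝ (LinearMap.range (LinearMap.id + ω)) = finrank ℝ V := by
  have hker : LinearMap.ker (LinearMap.id - ω) = LinearMap.range (LinearMap.id + ω) := by
    ext S
    simp only [LinearMap.mem_ker, LinearMap.mem_range, LinearMap.sub_apply, LinearMap.id_apply,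
      LinearMap.add_apply]
    constructor
    · intro h
      refine ⟨(2⁻¹ : ℝ) • S, ?_⟩
      rw [map_smul, ← sub_eq_zero.mp h]
      module
    · rintro ⟨T, rfl⟩
      rw [map_add, hω]
      abel
  have hbij : Function.Surjective J := LinearMap.injective_iff_surjective.mp hJ
  have hmap : (LinearMap.range (LinearMap.id + ω)).map J = LinearMap.range (LinearMap.id - ω) := by
    ext S
    simp only [Submodule.mem_map, LinearMap.mem_range, LinearMap.sub_apply, LinearMap.id_apply,
      LinearMap.add_apply]
    constructor
    · rintro ⟨_, ⟨T, rfl⟩, rfl⟩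
      exact ⟨J T, by rw [map_add, hJω]; abel⟩
    · rintro ⟨T, rfl⟩
      obtain ⟨T, rfl⟩ := hbij T
      exact ⟨_, ⟨T, rfl⟩, by rw [map_add, hJω]; abel⟩
  have h1 := (LinearMap.finrank_range_add_finrank_ker (LinearMap.id - ω : V →ₗ[ℝ] V))
  rw [hker, ← hmap, ← (Submodule.equivMapOfInjective J hJ _).finrank_eq] at h1
  omega

end Covering

namespace OrthogonalCliffordModule

variable {𝔷 𝔳 : Type*} [NormedAddCommGroup 𝔷] [InnerProductSpace ℝ 𝔷]
  [NormedAddCommGroup 𝔳] [InnerProductSpace ℝ 𝔳] (c : OrthogonalCliffordModule 𝔷 𝔳)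

/-! ### Orthonormal quadruples whose volume element fixes a spinor -/

/-- An orthonormal quadruple `e₁, e₂, e₃, e₄` orthogonal to `Z` whose Clifford volume element
`e₁ • e₂ • e₃ • e₄` fixes the spinor `S`. -/
structure IsFixingFrame (Z : 𝔷) (S : 𝔳) (e₁ e₂ e₃ e₄ : 𝔷) : Prop where
  norm₁ : ‖e₁‖ = 1
  norm₂ : ‖e₂‖ = 1
  norm₃ : ‖e₃‖ = 1
  norm₄ : ‖e₄‖ = 1
  inner₁₂ : ⟪e₁, e₂⟫ = 0
  inner₁₃ : ⟪e₁, e₃⟫ = 0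
  inner₁₄ : ⟪e₁, e₄⟫ = 0
  inner₂₃ : ⟪e₂, e₃⟫ = 0
  inner₂₄ : ⟪e₂, e₄⟫ = 0
  inner₃₄ : ⟪e₃, e₄⟫ = 0
  orth₁ : ⟪Z, e₁⟫ = 0
  orth₂ : ⟪Z, e₂⟫ = 0
  orth₃ : ⟪Z, e₃⟫ = 0
  orth₄ : ⟪Z, e₄⟫ = 0
  fixes : c.mul e₁ (c.mul e₂ (c.mul e₃ (c.mul e₄ S))) = S

/-- A plane rotation that makes the second vector orthogonal to `l`. -/
theorem exists_rotation (a b l : 𝔷) :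
    ∃ x y : ℝ, x ^ 2 + y ^ 2 = 1 ∧ ⟪l, x • b - y • a⟫ = 0 := by
  by_cases h : ⟪l, a⟫ ^ 2 + ⟪l, b⟫ ^ 2 = 0
  · have h1 : ⟪l, b⟫ = 0 := by nlinarith [sq_nonneg ⟪l, a⟫, sq_nonneg ⟪l, b⟫]
    exact ⟨1, 0, by norm_num, by simp [h1]⟩
  · have hpos : 0 < ⟪l, a⟫ ^ 2 + ⟪l, b⟫ ^ 2 := lt_of_le_of_ne (by positivity) (Ne.symm h)
    set r := √(⟪l, a⟫ ^ 2 + ⟪l, b⟫ ^ 2)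
    have hr0 : r ≠ 0 := (Real.sqrt_pos.mpr hpos).ne'
    have hr2 : r ^ 2 = ⟪l, a⟫ ^ 2 + ⟪l, b⟫ ^ 2 := Real.sq_sqrt hpos.le
    refine ⟨⟪l, a⟫ / r, ⟪l, b⟫ / r, ?_, ?_⟩
    · rw [div_pow, div_pow, ← add_div, hr2, div_self h]
    · rw [inner_sub_right, real_inner_smul_right, real_inner_smul_right]
      ring

theorem mul_mul_rotation {a b : 𝔷} (ha : ‖a‖ = 1) (hb : ‖b‖ = 1) (hab : ⟪a, b⟫ = 0) {x y : ℝ}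
    (hxy : x ^ 2 + y ^ 2 = 1) (S : 𝔳) :
    c.mul (x • a + y • b) (c.mul (x • b - y • a) S) = c.mul a (c.mul b S) := by
  simp only [map_add, map_sub, map_smul, LinearMap.add_apply, LinearMap.sub_apply,
    LinearMap.smul_apply, c.mul_mul_self_of_norm_eq_one ha, c.mul_mul_self_of_norm_eq_one hb]
  rw [c.mul_anticomm (A := b) (B := a) (by rwa [real_inner_comm]) S]
  set V := c.mul a (c.mul b S)
  calc _ = (x ^ 2 + y ^ 2) • V := by module
    _ = V := by rw [hxy, one_smul]

theorem norm_rotation {a b : 𝔷} (ha : ‖a‖ = 1) (hb : ‖b‖ = 1) (hab : ⟪a, b⟫ = 0) {x y : ℝ}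
    (hxy : x ^ 2 + y ^ 2 = 1) : ‖x • a + y • b‖ = 1 := by
  have h : ‖x • a + y • b‖ ^ 2 = 1 := by
    rw [@norm_add_sq_real, norm_smul, norm_smul, ha, hb, real_inner_smul_left,
      real_inner_smul_right, hab, Real.norm_eq_abs, Real.norm_eq_abs]
    simpa using hxy
  exact (pow_eq_one_iff_of_nonneg (norm_nonneg _) two_ne_zero).mp h

theorem norm_rotation' {a b : 𝔷} (ha : ‖a‖ = 1) (hb : ‖b‖ = 1) (hab : ⟪a, b⟫ = 0) {x y : ℝ}
    (hxy : x ^ 2 + y ^ 2 = 1) : ‖x • b - y • a‖ = 1 := by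
  have h := norm_rotation hb ha (by rwa [real_inner_comm]) (x := x) (y := -y) (by simpa using hxy)
  rwa [neg_smul, ← sub_eq_add_neg] at h

theorem inner_rotation {a b : 𝔷} (ha : ‖a‖ = 1) (hb : ‖b‖ = 1) (hab : ⟪a, b⟫ = 0) (x y : ℝ) :
    ⟪x • a + y • b, x • b - y • a⟫ = 0 := by
  have hba : ⟪b, a⟫ = 0 := by rwa [real_inner_comm]
  simp only [inner_add_left, inner_sub_right, real_inner_smul_left, real_inner_smul_right, hab,
    hba, real_inner_self_eq_norm_sq, ha, hb]
  ring

variable {c} {Z : 𝔷} {S : 𝔳} {e₁ e₂ e₃ e₄ : 𝔷}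

theorem IsFixingFrame.rotate₁₂ (h : c.IsFixingFrame Z S e₁ e₂ e₃ e₄) {x y : ℝ}
    (hxy : x ^ 2 + y ^ 2 = 1) :
    c.IsFixingFrame Z S (x • e₁ + y • e₂) (x • e₂ - y • e₁) e₃ e₄ where
  norm₁ := norm_rotation h.norm₁ h.norm₂ h.inner₁₂ hxy
  norm₂ := norm_rotation' h.norm₁ h.norm₂ h.inner₁₂ hxy
  norm₃ := h.norm₃
  norm₄ := h.norm₄
  inner₁₂ := inner_rotation h.norm₁ h.norm₂ h.inner₁₂ x y
  inner₁₃ := by simp [inner_add_left, real_inner_smul_left, h.inner₁₃, h.inner₂₃]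
  inner₁₄ := by simp [inner_add_left, real_inner_smul_left, h.inner₁₄, h.inner₂₄]
  inner₂₃ := by simp [inner_sub_left, real_inner_smul_left, h.inner₁₃, h.inner₂₃]
  inner₂₄ := by simp [inner_sub_left, real_inner_smul_left, h.inner₁₄, h.inner₂₄]
  inner₃₄ := h.inner₃₄
  orth₁ := by simp [inner_add_right, real_inner_smul_right, h.orth₁, h.orth₂]
  orth₂ := by simp [inner_sub_right, real_inner_smul_right, h.orth₁, h.orth₂]
  orth₃ := h.orth₃
  orth₄ := h.orth₄
  fixes := by rw [c.mul_mul_rotation h.norm₁ h.norm₂ h.inner₁₂ hxy, h.fixes]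

theorem IsFixingFrame.rotate₂₃ (h : c.IsFixingFrame Z S e₁ e₂ e₃ e₄) {x y : ℝ}
    (hxy : x ^ 2 + y ^ 2 = 1) :
    c.IsFixingFrame Z S e₁ (x • e₂ + y • e₃) (x • e₃ - y • e₂) e₄ where
  norm₁ := h.norm₁
  norm₂ := norm_rotation h.norm₂ h.norm₃ h.inner₂₃ hxy
  norm₃ := norm_rotation' h.norm₂ h.norm₃ h.inner₂₃ hxy
  norm₄ := h.norm₄
  inner₁₂ := by simp [inner_add_right, real_inner_smul_right, h.inner₁₂, h.inner₁₃]
  inner₁₃ := by simp [inner_sub_right, real_inner_smul_right, h.inner₁₂, h.inner₁₃]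
  inner₁₄ := h.inner₁₄
  inner₂₃ := inner_rotation h.norm₂ h.norm₃ h.inner₂₃ x y
  inner₂₄ := by simp [inner_add_left, real_inner_smul_left, h.inner₂₄, h.inner₃₄]
  inner₃₄ := by simp [inner_sub_left, real_inner_smul_left, h.inner₂₄, h.inner₃₄]
  orth₁ := h.orth₁
  orth₂ := by simp [inner_add_right, real_inner_smul_right, h.orth₂, h.orth₃]
  orth₃ := by simp [inner_sub_right, real_inner_smul_right, h.orth₂, h.orth₃]
  orth₄ := h.orth₄
  fixes := by rw [c.mul_mul_rotation h.norm₂ h.norm₃ h.inner₂₃ hxy, h.fixes]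

theorem IsFixingFrame.rotate₃₄ (h : c.IsFixingFrame Z S e₁ e₂ e₃ e₄) {x y : ℝ}
    (hxy : x ^ 2 + y ^ 2 = 1) :
    c.IsFixingFrame Z S e₁ e₂ (x • e₃ + y • e₄) (x • e₄ - y • e₃) where
  norm₁ := h.norm₁
  norm₂ := h.norm₂
  norm₃ := norm_rotation h.norm₃ h.norm₄ h.inner₃₄ hxy
  norm₄ := norm_rotation' h.norm₃ h.norm₄ h.inner₃₄ hxy
  inner₁₂ := h.inner₁₂
  inner₁₃ := by simp [inner_add_right, real_inner_smul_right, h.inner₁₃, h.inner₁₄]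
  inner₁₄ := by simp [inner_sub_right, real_inner_smul_right, h.inner₁₃, h.inner₁₄]
  inner₂₃ := by simp [inner_add_right, real_inner_smul_right, h.inner₂₃, h.inner₂₄]
  inner₂₄ := by simp [inner_sub_right, real_inner_smul_right, h.inner₂₃, h.inner₂₄]
  inner₃₄ := inner_rotation h.norm₃ h.norm₄ h.inner₃₄ x y
  orth₁ := h.orth₁
  orth₂ := h.orth₂
  orth₃ := by simp [inner_add_right, real_inner_smul_right, h.orth₃, h.orth₄]
  orth₄ := by simp [inner_sub_right, real_inner_smul_right, h.orth₃, h.orth₄]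
  fixes := by rw [c.mul_mul_rotation h.norm₃ h.norm₄ h.inner₃₄ hxy, h.fixes]

/-- Givens rotations bring a fixing frame into echelon form with respect to `l₁, l₂, l₃`. -/
theorem IsFixingFrame.exists_echelon (h : c.IsFixingFrame Z S e₁ e₂ e₃ e₄) (l₁ l₂ l₃ : 𝔷) :
    ∃ f₁ f₂ f₃ f₄, c.IsFixingFrame Z S f₁ f₂ f₃ f₄ ∧ ⟪l₁, f₂⟫ = 0 ∧ ⟪l₁, f₃⟫ = 0 ∧
      ⟪l₁, f₄⟫ = 0 ∧ ⟪l₂, f₃⟫ = 0 ∧ ⟪l₂, f₄⟫ = 0 ∧ ⟪l₃, f₄⟫ = 0 := by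
  -- clear the entries from the last vector upwards, one functional after the other, so that each
  -- rotation only mixes vectors on which the earlier functionals already vanish
  obtain ⟨x, y, hxy, h₁₄⟩ := exists_rotation e₃ e₄ l₁
  replace h := h.rotate₃₄ hxy
  generalize x • e₃ + y • e₄ = e₃ at *
  generalize x • e₄ - y • _ = e₄ at *
  obtain ⟨x, y, hxy, h₁₃⟩ := exists_rotation e₂ e₃ l₁
  replace h := h.rotate₂₃ hxy
  generalize x • e₂ + y • e₃ = e₂ at *
  generalize x • e₃ - y • _ = e₃ at *
  obtain ⟨x, y, hxy, h₁₂⟩ := exists_rotation e₁ e₂ l₁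
  replace h := h.rotate₁₂ hxy
  generalize x • e₁ + y • e₂ = e₁ at *
  generalize x • e₂ - y • _ = e₂ at *
  obtain ⟨x, y, hxy, h₂₄⟩ := exists_rotation e₃ e₄ l₂
  replace h := h.rotate₃₄ hxy
  have h₁₃' : ⟪l₁, x • e₃ + y • e₄⟫ = 0 := by
    simp [inner_add_right, real_inner_smul_right, h₁₃, h₁₄]
  have h₁₄' : ⟪l₁, x • e₄ - y • e₃⟫ = 0 := by
    simp [inner_sub_right, real_inner_smul_right, h₁₃, h₁₄]
  generalize x • e₃ + y • e₄ = e₃ at *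
  generalize x • e₄ - y • _ = e₄ at *
  obtain ⟨x, y, hxy, h₂₃⟩ := exists_rotation e₂ e₃ l₂
  replace h := h.rotate₂₃ hxy
  have h₁₂'' : ⟪l₁, x • e₂ + y • e₃⟫ = 0 := by
    simp [inner_add_right, real_inner_smul_right, h₁₂, h₁₃']
  have h₁₃'' : ⟪l₁, x • e₃ - y • e₂⟫ = 0 := by
    simp [inner_sub_right, real_inner_smul_right, h₁₂, h₁₃']
  generalize x • e₂ + y • e₃ = e₂ at *
  generalize x • e₃ - y • _ = e₃ at *
  obtain ⟨x, y, hxy, h₃₄⟩ := exists_rotation e₃ e₄ l₃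
  refine ⟨_, _, _, _, h.rotate₃₄ hxy, h₁₂'', ?_, ?_, ?_, ?_, h₃₄⟩ <;>
    simp [inner_add_right, inner_sub_right, real_inner_smul_right, *]

/-- The Clifford product `e₁ • e₂ • e₃ • e₄` as an operator. -/
def quadProduct (c : OrthogonalCliffordModule 𝔷 𝔳) (e₁ e₂ e₃ e₄ : 𝔷) : 𝔳 →ₗ[ℝ] 𝔳 :=
  c.mul e₁ ∘ₗ c.mul e₂ ∘ₗ c.mul e₃ ∘ₗ c.mul e₄

theorem quadProduct_apply (e₁ e₂ e₃ e₄ : 𝔷) (S : 𝔳) :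
    c.quadProduct e₁ e₂ e₃ e₄ S = c.mul e₁ (c.mul e₂ (c.mul e₃ (c.mul e₄ S))) := rfl

theorem IsFixingFrame.quadProduct_quadProduct (h : c.IsFixingFrame Z S e₁ e₂ e₃ e₄) (T : 𝔳) :
    c.quadProduct e₁ e₂ e₃ e₄ (c.quadProduct e₁ e₂ e₃ e₄ T) = T := by
  simp only [quadProduct_apply]
  rw [c.mul_anticomm (A := e₄) (B := e₁) (by rw [real_inner_comm]; exact h.inner₁₄)]
  simp only [map_neg]
  rw [c.mul_anticomm (A := e₃) (B := e₁) (by rw [real_inner_comm]; exact h.inner₁₃)]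
  simp only [map_neg]
  rw [c.mul_anticomm (A := e₂) (B := e₁) (by rw [real_inner_comm]; exact h.inner₁₂)]
  simp only [map_neg]
  rw [c.mul_mul_self_of_norm_eq_one h.norm₁]
  rw [c.mul_anticomm (A := e₄) (B := e₂) (by rw [real_inner_comm]; exact h.inner₂₄)]
  simp only [map_neg]
  rw [c.mul_anticomm (A := e₃) (B := e₂) (by rw [real_inner_comm]; exact h.inner₂₃)]
  simp only [map_neg]
  rw [c.mul_mul_self_of_norm_eq_one h.norm₂]
  rw [c.mul_anticomm (A := e₄) (B := e₃) (by rw [real_inner_comm]; exact h.inner₃₄)]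
  simp only [map_neg]
  rw [c.mul_mul_self_of_norm_eq_one h.norm₃]
  rw [c.mul_mul_self_of_norm_eq_one h.norm₄]
  simp only [neg_neg]

theorem IsFixingFrame.mul_quadProduct (h : c.IsFixingFrame Z S e₁ e₂ e₃ e₄) (T : 𝔳) :
    c.mul e₁ (c.quadProduct e₁ e₂ e₃ e₄ T) = -c.quadProduct e₁ e₂ e₃ e₄ (c.mul e₁ T) := by
  simp only [quadProduct_apply]
  rw [c.mul_anticomm (A := e₄) (B := e₁) (by rw [real_inner_comm]; exact h.inner₁₄)]
  simp only [map_neg]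
  rw [c.mul_anticomm (A := e₃) (B := e₁) (by rw [real_inner_comm]; exact h.inner₁₃)]
  simp only [map_neg, neg_neg]
  rw [c.mul_anticomm (A := e₂) (B := e₁) (by rw [real_inner_comm]; exact h.inner₁₂)]
  simp only [map_neg, neg_neg]

end OrthogonalCliffordModule

namespace OrthogonalCliffordModule

variable {𝔷 𝔳 : Type*} [NormedAddCommGroup 𝔷] [InnerProductSpace ℝ 𝔷]
  [NormedAddCommGroup 𝔳] [InnerProductSpace ℝ 𝔳] (c : OrthogonalCliffordModule 𝔷 𝔳)

/-! ### Genericity of spinors without fixing frame -/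

theorem quadProduct_smul (a₁ a₂ a₃ a₄ : ℝ) (p₁ p₂ p₃ p₄ : 𝔷) :
    c.quadProduct (a₁ • p₁) (a₂ • p₂) (a₃ • p₃) (a₄ • p₄) =
      (a₁ * a₂ * a₃ * a₄) • c.quadProduct p₁ p₂ p₃ p₄ := by
  ext T
  simp only [quadProduct_apply, map_smul, LinearMap.smul_apply, smul_smul]
  congr 1
  ring

variable [FiniteDimensional ℝ 𝔷] [FiniteDimensional ℝ 𝔳]

theorem contDiff_mul {P : Type*} [NormedAddCommGroup P] [NormedSpace ℝ P] {f : P → 𝔷} {h : P → 𝔳}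
    (hf : ContDiff ℝ 1 f) (hh : ContDiff ℝ 1 h) : ContDiff ℝ 1 fun x => c.mul (f x) (h x) :=
  ((LinearMap.toContinuousBilinearMap c.mul).contDiff.comp hf).clm_apply hh

/-- The smooth family `(p₁, …, p₄, T) ↦ T + σ • ω T`, where `ω` is the Clifford product of the
normalized vectors `p₁, …, p₄`. For pairwise orthogonal nonzero `p₁, …, p₄` and `σ = ± 1`, its
values are the spinors fixed by `σ • ω`. -/
def fixedSpinor (σ : ℝ) (p₁ p₂ p₃ p₄ : 𝔷) (T : 𝔳) : 𝔳 :=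
  T + (σ * (‖p₁‖ * ‖p₂‖ * ‖p₃‖ * ‖p₄‖)⁻¹) • c.quadProduct p₁ p₂ p₃ p₄ T

theorem contDiff_fixedSpinor {P : Type*} [NormedAddCommGroup P] [NormedSpace ℝ P] (σ : ℝ)
    {p₁ p₂ p₃ p₄ : P → 𝔷} {T : P → 𝔳} (h₁ : ContDiff ℝ 1 p₁) (h₂ : ContDiff ℝ 1 p₂)
    (h₃ : ContDiff ℝ 1 p₃) (h₄ : ContDiff ℝ 1 p₄) (hT : ContDiff ℝ 1 T)
    (n₁ : ∀ x, p₁ x ≠ 0) (n₂ : ∀ x, p₂ x ≠ 0) (n₃ : ∀ x, p₃ x ≠ 0) (n₄ : ∀ x, p₄ x ≠ 0) :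
    ContDiff ℝ 1 fun x => c.fixedSpinor σ (p₁ x) (p₂ x) (p₃ x) (p₄ x) (T x) := by
  refine hT.add ((contDiff_const.mul (ContDiff.inv ?_ fun x => ?_)).smul ?_)
  · exact (((h₁.norm ℝ n₁).mul (h₂.norm ℝ n₂)).mul (h₃.norm ℝ n₃)).mul (h₄.norm ℝ n₄)
  · have := norm_ne_zero_iff.mpr (n₁ x)
    have := norm_ne_zero_iff.mpr (n₂ x)
    have := norm_ne_zero_iff.mpr (n₃ x)
    have := norm_ne_zero_iff.mpr (n₄ x)
    positivity
  · exact c.contDiff_mul h₁ (c.contDiff_mul h₂ (c.contDiff_mul h₃ (c.contDiff_mul h₄ hT)))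

/-- For `dim 𝔳 > 8 * dim 𝔷 - 28`, generic spinors are not fixed by the Clifford volume element of
any orthonormal quadruple in the complement of `Z`: in echelon form such quadruples depend on
`4 * dim 𝔷 - 14` parameters, and each volume element fixes a subspace of half the dimension. -/
theorem dense_setOf_not_isFixingFrame {Z : 𝔷} (hZ : Z ≠ 0) (hn : 5 ≤ finrank ℝ 𝔷)
    (hdim : 8 * (finrank ℝ 𝔷 : ℤ) - 28 < (finrank ℝ 𝔳 : ℤ)) :
    Dense {S : 𝔳 | ¬∃ e₁ e₂ e₃ e₄, c.IsFixingFrame Z S e₁ e₂ e₃ e₄} := by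
  obtain ⟨m, hm⟩ := Nat.exists_eq_add_of_le' hn
  have hW₁ : finrank ℝ ((ℝ ∙ Z)ᗮ : Submodule ℝ 𝔷) = m + 3 + 1 := by
    have : Fact (finrank ℝ 𝔷 = m + 3 + 1 + 1) := ⟨hm⟩
    exact Submodule.finrank_orthogonal_span_singleton hZ
  set W₁ := ((ℝ ∙ Z)ᗮ : Submodule ℝ 𝔷)
  obtain ⟨l₁, W₂, hW₂, hl₁⟩ := exists_hyperplane W₁ hW₁
  obtain ⟨l₂, W₃, hW₃, hl₂⟩ := exists_hyperplane W₂ hW₂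
  obtain ⟨l₃, W₄, hW₄, hl₃⟩ := exists_hyperplane W₃ hW₃
  obtain ⟨f₁, g₁, hne₁, hcov₁⟩ := exists_affine_charts W₁ hW₁
  obtain ⟨f₂, g₂, hne₂, hcov₂⟩ := exists_affine_charts W₂ hW₂
  obtain ⟨f₃, g₃, hne₃, hcov₃⟩ := exists_affine_charts W₃ hW₃
  obtain ⟨f₄, g₄, hne₄, hcov₄⟩ := exists_affine_charts W₄ hW₄
  let r := finrank ℝ 𝔳 / 2
  let b := finBasis ℝ 𝔳
  let I := Bool × Fin (m + 3 + 1) × Fin (m + 2 + 1) × Fin (m + 1 + 1) × Fin (m + 1) ×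
    (Fin r → Fin (finrank ℝ 𝔳))
  let P := EuclideanSpace ℝ (Fin (m + 3)) × EuclideanSpace ℝ (Fin (m + 2)) ×
    EuclideanSpace ℝ (Fin (m + 1)) × EuclideanSpace ℝ (Fin m) × EuclideanSpace ℝ (Fin r)
  let Φ : I → P → 𝔳 := fun i x => c.fixedSpinor (if i.1 then 1 else -1)
    (f₁ i.2.1 + g₁ i.2.1 x.1) (f₂ i.2.2.1 + g₂ i.2.2.1 x.2.1)
    (f₃ i.2.2.2.1 + g₃ i.2.2.2.1 x.2.2.1) (f₄ i.2.2.2.2.1 + g₄ i.2.2.2.2.1 x.2.2.2.1)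
    (∑ k, x.2.2.2.2 k • b (i.2.2.2.2.2 k))
  have hΦ : ∀ i, ContDiff ℝ 1 (Φ i) := fun i => by
    have hlin : ∀ {V : Type _} [NormedAddCommGroup V] [NormedSpace ℝ V] [FiniteDimensional ℝ V]
        (g : V →ₗ[ℝ] 𝔷) (f : 𝔷) {p : P → V}, ContDiff ℝ 1 p →
        ContDiff ℝ 1 fun x => f + g (p x) := fun g f p hp =>
      contDiff_const.add ((LinearMap.toContinuousLinearMap g).contDiff.comp hp)
    refine c.contDiff_fixedSpinor _ (hlin _ _ (by fun_prop)) (hlin _ _ (by fun_prop))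
      (hlin _ _ (by fun_prop)) (hlin _ _ (by fun_prop)) ?_ (fun x => hne₁ _ _) (fun x => hne₂ _ _)
      (fun x => hne₃ _ _) (fun x => hne₄ _ _)
    fun_prop
  have hcover : {S : 𝔳 | ∃ e₁ e₂ e₃ e₄, c.IsFixingFrame Z S e₁ e₂ e₃ e₄} ⊆
      ⋃ i, Set.range (Φ i) := by
    rintro S ⟨e₁, e₂, e₃, e₄, h⟩
    obtain ⟨e₁, e₂, e₃, e₄, h, h₁₂, h₁₃, h₁₄, h₂₃, h₂₄, h₃₄⟩ := h.exists_echelon l₁ l₂ l₃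
    have hne : ∀ {e : 𝔷}, ‖e‖ = 1 → e ≠ 0 := fun he h0 => by simp [h0] at he
    have horth : ∀ {e : 𝔷}, ⟪Z, e⟫ = 0 → e ∈ W₁ := fun he =>
      Submodule.mem_orthogonal_singleton_iff_inner_right.mpr he
    obtain ⟨j₁, x₁, a₁, rfl⟩ := hcov₁ e₁ (horth h.orth₁) (hne h.norm₁)
    obtain ⟨j₂, x₂, a₂, rfl⟩ := hcov₂ e₂ (hl₁ _ (horth h.orth₂) h₁₂) (hne h.norm₂)
    obtain ⟨j₃, x₃, a₃, rfl⟩ := hcov₃ e₃ (hl₂ _ (hl₁ _ (horth h.orth₃) h₁₃) h₂₃) (hne h.norm₃)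
    obtain ⟨j₄, x₄, a₄, rfl⟩ :=
      hcov₄ e₄ (hl₃ _ (hl₂ _ (hl₁ _ (horth h.orth₄) h₁₄) h₂₄) h₃₄) (hne h.norm₄)
    set p₁ := f₁ j₁ + g₁ j₁ x₁
    set p₂ := f₂ j₂ + g₂ j₂ x₂
    set p₃ := f₃ j₃ + g₃ j₃ x₃
    set p₄ := f₄ j₄ + g₄ j₄ x₄
    set ω := c.quadProduct (a₁ • p₁) (a₂ • p₂) (a₃ • p₃) (a₄ • p₄) with hω
    have hrank : finrank ℝ (LinearMap.range (LinearMap.id + ω)) = r := by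
      have : 2 * finrank ℝ (LinearMap.range (LinearMap.id + ω)) = finrank ℝ 𝔳 :=
        finrank_range_id_add h.quadProduct_quadProduct (c.mul_injective (hne h.norm₁))
          h.mul_quadProduct
      omega
    obtain ⟨κ, hκ⟩ := exists_coordinates_of_mem_range b _ hrank
    have hωS : ω S = S := h.fixes
    obtain ⟨t, ht⟩ := hκ S ⟨(2⁻¹ : ℝ) • S, by
      rw [LinearMap.add_apply, map_smul, map_smul, hωS, LinearMap.id_apply]
      module⟩
    -- the unit vectors `aᵢ • pᵢ` determine `aᵢ` up to sign
    have habs : |a₁ * a₂ * a₃ * a₄| = (‖p₁‖ * ‖p₂‖ * ‖p₃‖ * ‖p₄‖)⁻¹ := by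
      have h₁ := h.norm₁
      have h₂ := h.norm₂
      have h₃ := h.norm₃
      have h₄ := h.norm₄
      rw [norm_smul, Real.norm_eq_abs] at h₁ h₂ h₃ h₄
      rw [abs_mul, abs_mul, abs_mul, eq_inv_of_mul_eq_one_left h₁, eq_inv_of_mul_eq_one_left h₂,
        eq_inv_of_mul_eq_one_left h₃, eq_inv_of_mul_eq_one_left h₄]
      simp only [mul_inv]
    have hsign : ∃ s : Bool, a₁ * a₂ * a₃ * a₄ =
        (if s then 1 else -1) * (‖p₁‖ * ‖p₂‖ * ‖p₃‖ * ‖p₄‖)⁻¹ := by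
      rw [← habs]
      rcases abs_choice (a₁ * a₂ * a₃ * a₄) with hs | hs
      · exact ⟨true, by simp [hs]⟩
      · exact ⟨false, by simp [hs]⟩
    obtain ⟨s, hs⟩ := hsign
    refine Set.mem_iUnion.mpr ⟨(s, j₁, j₂, j₃, j₄, κ), (x₁, x₂, x₃, x₄, t), ?_⟩
    rw [← ht, hω, quadProduct_smul, hs]
    rfl
  refine (dense_compl_of_dimH_lt_finrank
    ((dimH_mono hcover).trans_lt ?_) : Dense {S : 𝔳 | ∃ e₁ e₂ e₃ e₄, _}ᶜ)
  rw [dimH_iUnion]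
  have hP : finrank ℝ P < finrank ℝ 𝔳 := by
    simp only [P, finrank_prod, finrank_euclideanSpace_fin]
    omega
  exact (iSup_le fun i => (hΦ i).dimH_range_le).trans_lt (by exact_mod_cast hP)

/-! ### Isolation of eigenvalues off the ramification locus -/

theorem eventually_numEigenvalues {X : 𝔷 × 𝔳} (hX : X ∈ c.ramificationLocusᶜ) :
    ∀ᶠ Y in 𝓝 X, ∀ k : ℕ, 0 < k → c.numEigenvalues Y k = c.numEigenvalues X k :=
  (not_not.mp hX).2

theorem mem_domain {X : 𝔷 × 𝔳} (hX : X ∈ c.ramificationLocusᶜ) : X ∈ domain 𝔷 𝔳 :=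
  (not_not.mp hX).1

theorem isOpen_compl_ramificationLocus : IsOpen c.ramificationLocusᶜ := by
  rw [isOpen_iff_mem_nhds]
  intro X hX
  filter_upwards [(isOpen_domain 𝔷 𝔳).mem_nhds (c.mem_domain hX), c.eventually_numEigenvalues hX,
    (c.eventually_numEigenvalues hX).eventually_nhds] with Y hY h1 h2
  refine not_not.mpr ⟨hY, h2.mono fun Y' h k hk => ?_⟩
  rw [h k hk, h1 k hk]

/-- The finite set of eigenvalues of `negCheckKSq X`. -/
def eigenvalueFinset (X : 𝔷 × 𝔳) : Finset ℝ :=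
  (End.finite_hasEigenvalue (c.negCheckKSq X)).toFinset

theorem mem_eigenvalueFinset {X : 𝔷 × 𝔳} {t : ℝ} :
    t ∈ c.eigenvalueFinset X ↔ End.HasEigenvalue (c.negCheckKSq X) t := by
  simp [eigenvalueFinset]

theorem setOf_multiplicity_eq_finite (X : 𝔷 × 𝔳) {k : ℕ} (hk : 0 < k) :
    {t | c.multiplicity X t = k}.Finite :=
  (End.finite_hasEigenvalue (c.negCheckKSq X)).subset fun _ ht =>
    (c.multiplicity_pos_iff X _).mp (hk.trans_eq ht.symm)

theorem card_eigenvalueFinset (X : 𝔷 × 𝔳) :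
    (c.eigenvalueFinset X).card = ∑ k ∈ Finset.Icc 1 (finrank ℝ 𝔷), c.numEigenvalues X k := by
  rw [Finset.card_eq_sum_card_fiberwise (f := c.multiplicity X)
    (t := Finset.Icc 1 (finrank ℝ 𝔷))]
  · refine Finset.sum_congr rfl fun k hk => ?_
    rw [numEigenvalues, ← Set.ncard_coe_finset]
    congr 1
    ext t
    simp only [Finset.coe_filter, Set.mem_ofPred_eq, mem_eigenvalueFinset,
      ← c.multiplicity_pos_iff]
    have := (Finset.mem_Icc.mp hk).1
    constructor
    · exact fun h => h.2
    · exact fun h => ⟨by omega, h⟩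
  · intro t ht
    have h := (c.multiplicity_pos_iff X t).mpr (c.mem_eigenvalueFinset.mp ht)
    exact Finset.mem_coe.mpr (Finset.mem_Icc.mpr ⟨h, Submodule.finrank_le _⟩)

/-- Off the ramification locus an eigenvalue does not split: near `X` there is just one eigenvalue
close to the eigenvalue `t₀` of `negCheckKSq X`, since every eigenvalue at `X` attracts at least
one and the number of eigenvalues is constant. -/
theorem eventually_exists_unique_eigenvalue_near {X : 𝔷 × 𝔳} (hX : X ∈ c.ramificationLocusᶜ)
    {t₀ : ℝ} (ht₀ : End.HasEigenvalue (c.negCheckKSq X) t₀) :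
    ∃ δ > 0, ∀ᶠ Y in 𝓝 X, ∃ t, |t - t₀| ≤ δ ∧
      ∀ x, End.HasEigenvalue (c.negCheckKSq Y) x → x = t ∨ δ ≤ |x - t₀| := by
  have hsep : ∃ δ > 0, ∀ p ∈ (c.eigenvalueFinset X).offDiag, 2 * δ ≤ |p.1 - p.2| := by
    rcases (c.eigenvalueFinset X).offDiag.eq_empty_or_nonempty with he | hne
    · exact ⟨1, one_pos, by simp [he]⟩
    · obtain ⟨p, hp, hmin⟩ := Finset.exists_min_image _ (fun p : ℝ × ℝ => |p.1 - p.2|) hne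
      have hp' : 0 < |p.1 - p.2| := abs_pos.mpr (sub_ne_zero.mpr (Finset.mem_offDiag.mp hp).2.2)
      exact ⟨|p.1 - p.2| / 2, by positivity, fun q hq => by linarith [hmin q hq]⟩
  obtain ⟨δ, hδ, hsep⟩ := hsep
  refine ⟨δ, hδ, ?_⟩
  have hnear : ∀ᶠ Y in 𝓝 X, ∀ u ∈ c.eigenvalueFinset X,
      ∃ t, End.HasEigenvalue (c.negCheckKSq Y) t ∧ |t - u| < δ := by
    rw [Filter.eventually_all_finset]
    intro u hu
    obtain ⟨v, hv, hv0⟩ := (c.mem_eigenvalueFinset.mp hu).exists_hasEigenvector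
    have hcont : ContinuousAt (fun Y => ‖c.negCheckKSq Y v - u • v‖) X :=
      ((continuousAt_clm_apply.mp (c.continuousAt_negCheckKSq (c.mem_domain hX)) v).sub
        continuousAt_const).norm
    have h0 : ‖c.negCheckKSq X v - u • v‖ < δ * ‖v‖ := by
      rw [End.mem_eigenspace_iff.mp hv, sub_self, norm_zero]
      positivity
    filter_upwards [hcont.eventually_lt_const h0] with Y hY
    exact exists_hasEigenvalue_near (c.negCheckKSq_isSymmetric Y) hY
  filter_upwards [hnear, c.eventually_numEigenvalues hX] with Y hY hnum
  choose! φ hφ hφδ using hY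
  have hinj : Set.InjOn φ (c.eigenvalueFinset X) := by
    intro u hu w hw huw
    by_contra hne
    have h1 : 2 * δ ≤ |u - w| := hsep (u, w) (Finset.mem_offDiag.mpr ⟨hu, hw, hne⟩)
    have h2 := hφδ u hu
    have h3 := hφδ w hw
    have h4 := abs_sub_le u (φ u) w
    rw [← huw] at h3
    rw [abs_sub_comm] at h2
    linarith
  have hcard : (c.eigenvalueFinset Y).card = (c.eigenvalueFinset X).card := by
    rw [card_eigenvalueFinset, card_eigenvalueFinset]
    exact Finset.sum_congr rfl fun k hk => hnum k (Finset.mem_Icc.mp hk).1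
  have himage : (c.eigenvalueFinset X).image φ = c.eigenvalueFinset Y := by
    refine Finset.eq_of_subset_of_card_le ?_ ?_
    · intro x hx
      obtain ⟨u, hu, rfl⟩ := Finset.mem_image.mp hx
      exact c.mem_eigenvalueFinset.mpr (hφ u hu)
    · rw [Finset.card_image_of_injOn hinj, hcard]
  have ht₀' := c.mem_eigenvalueFinset.mpr ht₀
  refine ⟨φ t₀, (hφδ t₀ ht₀').le, fun x hx => ?_⟩
  rw [← c.mem_eigenvalueFinset, ← himage, Finset.mem_image] at hx
  obtain ⟨u, hu, rfl⟩ := hx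
  by_cases hut : u = t₀
  · exact Or.inl (by rw [hut])
  · right
    have h1 := hsep (u, t₀) (Finset.mem_offDiag.mpr ⟨hu, ht₀', hut⟩)
    have h2 := hφδ u hu
    have h3 := abs_sub_le u (φ u) t₀
    rw [abs_sub_comm] at h2
    simp only at h1
    linarith

/-! ### First variation in the direction of `𝔳` -/

/-- The derivative of `S ↦ hatK (Z, S)` in the direction of `T`. -/
def hatKDeriv (Z : 𝔷) (S T : 𝔳) : 𝔷 →ₗ[ℝ] 𝔷 :=
  c.spinorProduct S ∘ₗ c.mul.flip (c.mul Z T) + c.spinorProduct T ∘ₗ c.mul.flip (c.mul Z S)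

theorem hatK_add_smul (Z : 𝔷) (S T : 𝔳) (s : ℝ) (A : 𝔷) :
    c.hatK (Z, S + s • T) A =
      c.hatK (Z, S) A + s • c.hatKDeriv Z S T A + s ^ 2 • c.hatK (Z, T) A := by
  refine ext_inner_left ℝ fun B => ?_
  simp only [hatK, hatKDeriv, LinearMap.comp_apply, LinearMap.add_apply, LinearMap.smul_apply,
    LinearMap.flip_apply, inner_add_right, real_inner_smul_right, inner_spinorProduct, map_add,
    map_smul, inner_add_left, real_inner_smul_left]
  ring

theorem inner_hatKDeriv {Z A B : 𝔷} (hA : ⟪Z, A⟫ = 0) (hB : ⟪Z, B⟫ = 0) (hAB : ⟪A, B⟫ = 0)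
    (S T : 𝔳) : ⟪B, c.hatKDeriv Z S T A⟫ = -2 * ⟪c.mul B (c.mul A (c.mul Z S)), T⟫ := by
  have h1 : ⟪c.mul B S, c.mul A (c.mul Z T)⟫ = -⟪c.mul B (c.mul A (c.mul Z S)), T⟫ := by
    have e1 := c.inner_mul_left A (c.mul B S) (c.mul Z T)
    have e2 := c.inner_mul_left Z (c.mul A (c.mul B S)) T
    rw [c.mul_anticomm hA, c.mul_anticomm hB, map_neg, neg_neg, c.mul_anticomm hAB,
      inner_neg_left] at e2
    linarith
  have h2 : ⟪c.mul B T, c.mul A (c.mul Z S)⟫ = -⟪c.mul B (c.mul A (c.mul Z S)), T⟫ := by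
    rw [c.inner_mul_left, real_inner_comm]
  simp only [hatKDeriv, LinearMap.comp_apply, LinearMap.add_apply, LinearMap.flip_apply,
    inner_add_right, inner_spinorProduct]
  rw [h1, h2]
  ring

theorem hasDerivAt_hatK (Z : 𝔷) (S T : 𝔳) (A : 𝔷) :
    HasDerivAt (fun s : ℝ => c.hatK (Z, S + s • T) A) (c.hatKDeriv Z S T A) 0 := by
  simp only [hatK_add_smul]
  have h1 : HasDerivAt (fun s : ℝ => s • c.hatKDeriv Z S T A) ((1 : ℝ) • c.hatKDeriv Z S T A) 0 :=
    (hasDerivAt_id (0 : ℝ)).smul_const _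
  have h2 : HasDerivAt (fun s : ℝ => s ^ 2 • c.hatK (Z, T) A)
      (((2 : ℕ) * (0 : ℝ) ^ (2 - 1)) • c.hatK (Z, T) A) 0 :=
    (hasDerivAt_pow 2 (0 : ℝ)).smul_const _
  have h := (h1.const_add (c.hatK (Z, S) A)).fun_add h2
  simpa using h

theorem differentiableAt_negCheckKSq {Z : 𝔷} {S : 𝔳} (hX : (Z, S) ∈ domain 𝔷 𝔳) (T : 𝔳) (A : 𝔷) :
    DifferentiableAt ℝ (fun s : ℝ => c.negCheckKSq (Z, S + s • T) A) 0 := by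
  have hr : DifferentiableAt ℝ (fun s : ℝ => (‖Z‖ * ‖S + s • T‖ ^ 2)⁻¹) 0 := by
    refine DifferentiableAt.inv ?_ ?_
    · exact (DifferentiableAt.norm_sq ℝ (by fun_prop)).const_mul _
    · have h1 := norm_ne_zero_iff.mpr hX.1
      have h2 := norm_ne_zero_iff.mpr hX.2
      rw [zero_smul, add_zero]
      positivity
  have hK : ∀ w : ℝ → 𝔷, DifferentiableAt ℝ w 0 →
      DifferentiableAt ℝ (fun s : ℝ => c.checkK (Z, S + s • T) (w s)) 0 := by
    intro w hw
    have hlin : ∀ L : 𝔷 →ₗ[ℝ] 𝔷, DifferentiableAt ℝ (fun s => L (w s)) 0 := fun L =>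
      (LinearMap.toContinuousLinearMap L).differentiableAt.comp 0 hw
    simp only [checkK, LinearMap.smul_apply, hatK_add_smul]
    exact hr.smul (((hlin _).add (differentiableAt_id.smul (hlin _))).add
      ((differentiableAt_id.pow 2).smul (hlin _)))
  exact (hK _ (hK _ (differentiableAt_const A))).neg

theorem norm_hatK_sq {X : 𝔷 × 𝔳} (hX : X ∈ domain 𝔷 𝔳) (A : 𝔷) :
    ‖c.hatK X A‖ ^ 2 = (‖X.1‖ * ‖X.2‖ ^ 2) ^ 2 * ⟪c.negCheckKSq X A, A⟫ := by
  have h1 := norm_ne_zero_iff.mpr hX.1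
  have h2 := norm_ne_zero_iff.mpr hX.2
  rw [c.inner_negCheckKSq, real_inner_self_eq_norm_sq, checkK, LinearMap.smul_apply, norm_smul,
    norm_inv, Real.norm_of_nonneg (by positivity)]
  field_simp

/-- Off the ramification locus all unit vectors of an eigenspace have the same first variation. -/
theorem inner_hatK_hatKDeriv_eq {Z : 𝔷} {S : 𝔳} (hX : (Z, S) ∈ c.ramificationLocusᶜ) {t₀ : ℝ}
    {A B : 𝔷} (hA : A ∈ End.eigenspace (c.negCheckKSq (Z, S)) t₀)
    (hB : B ∈ End.eigenspace (c.negCheckKSq (Z, S)) t₀) (hA1 : ‖A‖ = 1) (hB1 : ‖B‖ = 1) (T : 𝔳) :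
    ⟪c.hatK (Z, S) A, c.hatKDeriv Z S T A⟫ = ⟪c.hatK (Z, S) B, c.hatKDeriv Z S T B⟫ := by
  have hdom := c.mem_domain hX
  have ht₀ : End.HasEigenvalue (c.negCheckKSq (Z, S)) t₀ :=
    End.hasEigenvalue_of_hasEigenvector ⟨hA, fun h => by simp [h] at hA1⟩
  obtain ⟨δ, hδ, hev⟩ := c.eventually_exists_unique_eigenvalue_near hX ht₀
  have hpath : Continuous fun s : ℝ => ((Z, S + s • T) : 𝔷 × 𝔳) := by fun_prop
  have htends : Filter.Tendsto (fun s : ℝ => ((Z, S + s • T) : 𝔷 × 𝔳)) (𝓝 0) (𝓝 (Z, S)) := by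
    simpa using hpath.tendsto 0
  set Q := fun s : ℝ => c.negCheckKSq (Z, S + s • T)
  have hbigO : ∀ {C : 𝔷}, C ∈ End.eigenspace (c.negCheckKSq (Z, S)) t₀ →
      (fun s => ‖Q s C - t₀ • C‖ ^ 2) =O[𝓝 0] fun s : ℝ => ‖s - 0‖ ^ 2 := by
    intro C hC
    have h := (c.differentiableAt_negCheckKSq hdom T C).isBigO_sub
    simp only [zero_smul, add_zero, End.mem_eigenspace_iff.mp hC] at h
    exact h.norm_norm.pow 2
  -- the two values differ by a quantity of second order, so the derivatives agree
  have hdiff : (fun s => ‖c.hatK (Z, S + s • T) A‖ ^ 2 - ‖c.hatK (Z, S + s • T) B‖ ^ 2)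
      =O[𝓝 0] fun s : ℝ => ‖s - 0‖ ^ 2 := by
    have h1 : (fun s => ⟪Q s A, A⟫ - ⟪Q s B, B⟫) =O[𝓝 0] fun s : ℝ => ‖s - 0‖ ^ 2 := by
      refine Asymptotics.IsBigO.trans (Asymptotics.IsBigO.of_bound (2 / δ) ?_)
        ((hbigO hA).add (hbigO hB))
      filter_upwards [htends.eventually hev] with s ⟨t, ht, hsep⟩
      have hsym := c.negCheckKSq_isSymmetric (Z, S + s • T)
      have e1 := abs_inner_apply_self_sub_le hsym hδ ht hsep A
      have e2 := abs_inner_apply_self_sub_le hsym hδ ht hsep B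
      rw [hA1] at e1
      rw [hB1] at e2
      have e3 := abs_sub (⟪Q s A, A⟫ - t * 1 ^ 2) (⟪Q s B, B⟫ - t * 1 ^ 2)
      rw [sub_sub_sub_cancel_right] at e3
      rw [Real.norm_eq_abs, Real.norm_eq_abs, abs_of_nonneg (a := _ + _) (by positivity), mul_add]
      exact e3.trans (add_le_add e1 e2)
    have h2 : (fun s : ℝ => (‖Z‖ * ‖S + s • T‖ ^ 2) ^ 2) =O[𝓝 0] fun _ => (1 : ℝ) := by
      have hc : Continuous fun s : ℝ => (‖Z‖ * ‖S + s • T‖ ^ 2) ^ 2 := by fun_prop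
      exact (hc.tendsto 0).isBigO_one ℝ
    have h3 := h2.mul h1
    simp only [one_mul] at h3
    refine h3.congr' ?_ Filter.EventuallyEq.rfl
    filter_upwards [htends.eventually ((isOpen_domain 𝔷 𝔳).mem_nhds hdom)] with s hs
    rw [c.norm_hatK_sq hs, c.norm_hatK_sq hs, mul_sub]
  have hzero : HasDerivAt
      (fun s : ℝ => ‖c.hatK (Z, S + s • T) A‖ ^ 2 - ‖c.hatK (Z, S + s • T) B‖ ^ 2) 0 0 := by
    have h := (hdiff.hasFDerivAt (by norm_num)).hasDerivAt
    simpa using h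
  have hderiv := (c.hasDerivAt_hatK Z S T A).norm_sq.sub (c.hasDerivAt_hatK Z S T B).norm_sq
  have h := hzero.unique hderiv
  simp only [zero_smul, add_zero] at h
  linarith

/-- If a nonzero eigenvalue has multiplicity at least three at a point `(Z, S)` off the
ramification locus, the first variation produces a Clifford volume element fixing `S`. -/
theorem exists_isFixingFrame {Z : 𝔷} {S : 𝔳} (hX : (Z, S) ∈ c.ramificationLocusᶜ) {t₀ : ℝ}
    (ht₀ : t₀ ≠ 0) (hm : 3 ≤ c.multiplicity (Z, S) t₀) :
    ∃ e₁ e₂ e₃ e₄, c.IsFixingFrame Z S e₁ e₂ e₃ e₄ := by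
  have hdom := c.mem_domain hX
  set V := End.eigenspace (c.negCheckKSq (Z, S)) t₀
  set K := c.checkK (Z, S) with hK
  have hexists : ∀ W : Submodule ℝ 𝔷, finrank ℝ W ≤ 2 →
      ∃ A ∈ V, ‖A‖ = 1 ∧ ∀ w ∈ W, ⟪w, A⟫ = 0 := by
    intro W hW
    have hne : ¬Disjoint V Wᗮ := fun hd => by
      have h1 := Submodule.finrank_add_finrank_le_of_disjoint hd
      have h2 := W.finrank_add_finrank_orthogonal
      change 3 ≤ finrank ℝ V at hm
      omega
    rw [Submodule.disjoint_def] at hne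
    push Not at hne
    obtain ⟨A, hA, hAW, hA0⟩ := hne
    refine ⟨‖A‖⁻¹ • A, V.smul_mem _ hA, norm_smul_inv_norm hA0, fun w hw => ?_⟩
    rw [real_inner_smul_right, hAW w hw, mul_zero]
  obtain ⟨A, hA, hA1, -⟩ := hexists ⊥ (by simp)
  obtain ⟨B, hB, hB1, hBW⟩ := hexists (Submodule.span ℝ (Set.range ![A, K A]))
    (finrank_range_le_card ![A, K A])
  have hAB : ⟪A, B⟫ = 0 := hBW _ (Submodule.subset_span ⟨0, rfl⟩)
  have hKAB : ⟪K A, B⟫ = 0 := hBW _ (Submodule.subset_span ⟨1, rfl⟩)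
  have hpos : 0 < t₀ := by
    have h := c.norm_checkK_sq hA
    rw [hA1] at h
    exact lt_of_le_of_ne (by nlinarith [sq_nonneg ‖K A‖]) ht₀.symm
  set q := √t₀
  have hq0 : 0 < q := Real.sqrt_pos.mpr hpos
  have hq2 : q ^ 2 = t₀ := Real.sq_sqrt hpos.le
  -- the complex structure `q⁻¹ • K` of the eigenspace
  have hIV : ∀ C ∈ V, q⁻¹ • K C ∈ V := fun C hC =>
    V.smul_mem _ (c.checkK_mem_eigenspace hC)
  have hI1 : ∀ C ∈ V, ‖C‖ = 1 → ‖q⁻¹ • K C‖ = 1 := fun C hC hC1 => by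
    have h := c.norm_checkK_sq hC
    rw [hC1, ← hq2, one_pow, mul_one] at h
    have h' : ‖K C‖ = q := (sq_eq_sq₀ (norm_nonneg _) hq0.le).mp h
    rw [norm_smul, h', norm_inv, Real.norm_of_nonneg hq0.le, inv_mul_cancel₀ hq0.ne']
  have hIorth : ∀ C, ⟪C, q⁻¹ • K C⟫ = 0 := fun C => by
    rw [real_inner_smul_right, real_inner_comm, c.inner_checkK_self, mul_zero]
  have hZV : ∀ C ∈ V, ⟪Z, C⟫ = 0 := fun C hC =>
    inner_eigenspace_eq_zero (c.negCheckKSq_isSymmetric _) ht₀.symm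
      (c.fst_mem_eigenspace_zero (Z, S)) hC
  have hAIB : ⟪A, q⁻¹ • K B⟫ = 0 := by
    have h := c.inner_checkK_left (Z, S) A B
    rw [real_inner_smul_right]
    change ⟪K A, B⟫ = -⟪A, K B⟫ at h
    rw [show ⟪A, K B⟫ = 0 by linarith, mul_zero]
  have hIAB : ⟪q⁻¹ • K A, B⟫ = 0 := by rw [real_inner_smul_left, hKAB, mul_zero]
  have hIAIB : ⟪q⁻¹ • K A, q⁻¹ • K B⟫ = 0 := by
    rw [real_inner_smul_left, real_inner_smul_right, ← c.inner_negCheckKSq,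
      End.mem_eigenspace_iff.mp hA, real_inner_smul_left, hAB]
    ring
  -- the first variation of the eigenvalue, computed with `A` and with `B`
  have hvar : c.mul (q⁻¹ • K A) (c.mul A (c.mul Z S)) =
      c.mul (q⁻¹ • K B) (c.mul B (c.mul Z S)) := by
    refine ext_inner_right ℝ fun T => ?_
    have h := c.inner_hatK_hatKDeriv_eq hX hA hB hA1 hB1 T
    set ρ := ‖Z‖ * ‖S‖ ^ 2
    have hρ0 : ρ ≠ 0 := by
      have h1 := norm_ne_zero_iff.mpr hdom.1
      have h2 := norm_ne_zero_iff.mpr hdom.2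
      positivity
    have hhat : ∀ C, c.hatK (Z, S) C = (ρ * q) • (q⁻¹ • K C) := fun C => by
      rw [smul_smul, mul_assoc, mul_inv_cancel₀ hq0.ne', mul_one, hK, checkK,
        LinearMap.smul_apply, smul_smul, mul_inv_cancel₀ hρ0, one_smul]
    rw [hhat A, hhat B, real_inner_smul_left _ _ (ρ * q), real_inner_smul_left _ _ (ρ * q),
      c.inner_hatKDeriv (hZV A hA) (hZV _ (hIV A hA)) (hIorth A),
      c.inner_hatKDeriv (hZV B hB) (hZV _ (hIV B hB)) (hIorth B)] at h
    have h' := mul_left_cancel₀ (mul_ne_zero hρ0 hq0.ne') h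
    linarith
  refine ⟨A, q⁻¹ • K A, q⁻¹ • K B, B, hA1, hI1 A hA hA1, hI1 B hB hB1, hB1, hIorth A, hAIB, hAB,
    hIAIB, hIAB, ?_, hZV A hA, hZV _ (hIV A hA), hZV _ (hIV B hB), hZV B hB, ?_⟩
  · rw [real_inner_comm]
    exact hIorth B
  · -- the volume element commutes with `Z`, so it suffices to evaluate it on `Z • S`
    refine c.mul_injective hdom.1 ?_
    rw [c.mul_anticomm (hZV A hA), c.mul_anticomm (hZV _ (hIV A hA)),
      c.mul_anticomm (hZV _ (hIV B hB)), c.mul_anticomm (hZV B hB)]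
    simp only [map_neg, neg_neg]
    rw [← hvar, c.mul_mul_self_of_norm_eq_one (hI1 A hA hA1), map_neg,
      c.mul_mul_self_of_norm_eq_one hA1, neg_neg]

/-! ### Multiplicities off the ramification locus -/

theorem numEigenvalues_pos_iff (X : 𝔷 × 𝔳) {k : ℕ} (hk : 0 < k) :
    0 < c.numEigenvalues X k ↔ ∃ t, c.multiplicity X t = k := by
  rw [numEigenvalues, Set.ncard_pos (c.setOf_multiplicity_eq_finite X hk)]
  rfl

theorem multiplicity_zero_pos {X : 𝔷 × 𝔳} (hX : X ∈ domain 𝔷 𝔳) : 0 < c.multiplicity X 0 :=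
  (c.multiplicity_pos_iff X 0).mpr
    (End.hasEigenvalue_of_hasEigenvector ⟨c.fst_mem_eigenspace_zero X, hX.1⟩)

/-- The dimension of the kernel is upper semicontinuous. -/
theorem eventually_multiplicity_zero_le {X : 𝔷 × 𝔳} (hX : X ∈ domain 𝔷 𝔳) :
    ∀ᶠ Y in 𝓝 X, c.multiplicity Y 0 ≤ c.multiplicity X 0 := by
  obtain ⟨ε, hε, h⟩ := c.eventually_multiplicity_add_le hX
  filter_upwards [h] with Y hY
  have := hY (ε / 2) (by positivity) (by rw [abs_of_pos (by positivity)]; linarith)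
  omega

/-- Every nonzero eigenvalue off the ramification locus is double: this holds at generic nearby
points, and a multiplicity other than `2` at `X` would be that of the kernel at these points, hence
be taken only once, whereas the kernel at `X` is no smaller. -/
theorem multiplicity_eq_two (hn : 5 ≤ finrank ℝ 𝔷)
    (hdim : 8 * (finrank ℝ 𝔷 : ℤ) - 28 < (finrank ℝ 𝔳 : ℤ)) {X : 𝔷 × 𝔳}
    (hX : X ∈ c.ramificationLocusᶜ) {t : ℝ} (ht : t ≠ 0) (hm : 0 < c.multiplicity X t) :
    c.multiplicity X t = 2 := by
  have hdom := c.mem_domain hX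
  have hev : ∀ᶠ Y in 𝓝 X, Y ∈ c.ramificationLocusᶜ ∧
      (∀ k : ℕ, 0 < k → c.numEigenvalues Y k = c.numEigenvalues X k) ∧
      c.multiplicity Y 0 ≤ c.multiplicity X 0 :=
    Filter.Eventually.and (c.isOpen_compl_ramificationLocus.mem_nhds hX)
      ((c.eventually_numEigenvalues hX).and (c.eventually_multiplicity_zero_le hdom))
  have hpath : Filter.Tendsto (fun S : 𝔳 => (X.1, S)) (𝓝 X.2) (𝓝 X) :=
    (Continuous.prodMk_right X.1).tendsto X.2
  obtain ⟨S, hS, hY, hnum, hzero⟩ :=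
    (c.dense_setOf_not_isFixingFrame hdom.1 hn hdim).inter_nhds_nonempty (hpath.eventually hev)
  have hYtwo : ∀ s, s ≠ 0 → 0 < c.multiplicity (X.1, S) s → c.multiplicity (X.1, S) s = 2 := by
    intro s hs hpos
    have h1 := c.two_le_multiplicity hs hpos
    by_contra hne
    exact hS (c.exists_isFixingFrame hY hs (by omega))
  have honly : ∀ s, 0 < c.multiplicity X s → c.multiplicity X s ≠ 2 →
      ∀ s', c.multiplicity (X.1, S) s' = c.multiplicity X s → s' = 0 := by
    intro s hpos hne s' hs'
    by_contra hs'0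
    exact hne (hs'.symm.trans (hYtwo s' hs'0 (hs' ▸ hpos)))
  have hattained : ∀ s, 0 < c.multiplicity X s → c.multiplicity X s ≠ 2 →
      c.multiplicity (X.1, S) 0 = c.multiplicity X s := by
    intro s hpos hne
    have h := (c.numEigenvalues_pos_iff X hpos).mpr ⟨s, rfl⟩
    rw [← hnum _ hpos, c.numEigenvalues_pos_iff _ hpos] at h
    obtain ⟨s', hs'⟩ := h
    rw [← hs', honly s hpos hne s' hs']
  by_contra hne
  have h2 := c.two_le_multiplicity ht hm
  have h3 := hattained t hm hne
  -- the kernel at `X` is as large as that at the generic point, so it has the same dimension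
  have h4 := hattained 0 (by omega) (by omega)
  have h5 : 1 < c.numEigenvalues X (c.multiplicity X t) :=
    (Set.one_lt_ncard (c.setOf_multiplicity_eq_finite X hm)).mpr
      ⟨t, rfl, 0, h4.symm.trans h3, ht⟩
  have h6 : c.numEigenvalues (X.1, S) (c.multiplicity X t) ≤ 1 :=
    (Set.ncard_le_one (c.setOf_multiplicity_eq_finite _ hm)).mpr fun a ha b hb =>
      (honly t hm hne a ha).trans (honly t hm hne b hb).symm
  rw [hnum _ hm] at h6
  omega

theorem eventually_multiplicity_zero_eq (hn : 5 ≤ finrank ℝ 𝔷)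
    (hdim : 8 * (finrank ℝ 𝔷 : ℤ) - 28 < (finrank ℝ 𝔳 : ℤ)) {X : 𝔷 × 𝔳}
    (hX : X ∈ c.ramificationLocusᶜ) :
    ∀ᶠ Y in 𝓝 X, c.multiplicity Y 0 = c.multiplicity X 0 := by
  have hdom := c.mem_domain hX
  filter_upwards [c.isOpen_compl_ramificationLocus.mem_nhds hX, c.eventually_numEigenvalues hX]
    with Y hY hnum
  -- a kernel of dimension other than `2` is the only eigenspace of its dimension
  have key : ∀ {X Y : 𝔷 × 𝔳}, X ∈ c.ramificationLocusᶜ → Y ∈ c.ramificationLocusᶜ →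
      (∀ k : ℕ, 0 < k → c.numEigenvalues Y k = c.numEigenvalues X k) →
      c.multiplicity X 0 ≠ 2 → c.multiplicity Y 0 = c.multiplicity X 0 := by
    intro X Y hX hY hnum h2
    have hpos := c.multiplicity_zero_pos (c.mem_domain hX)
    have h := (c.numEigenvalues_pos_iff X hpos).mpr ⟨0, rfl⟩
    rw [← hnum _ hpos, c.numEigenvalues_pos_iff Y hpos] at h
    obtain ⟨s, hs⟩ := h
    by_cases hs0 : s = 0
    · rw [← hs, hs0]
    · exact absurd (hs.symm.trans (c.multiplicity_eq_two hn hdim hY hs0 (hs ▸ hpos))) h2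
  by_cases h2 : c.multiplicity X 0 = 2
  · by_contra hne
    exact hne (key hY hX (fun k hk => (hnum k hk).symm) (by rwa [h2] at hne)).symm
  · exact key hX hY hnum h2

/-- An eigenvalue branch vanishes either everywhere or nowhere, as the dimension of the kernel is
locally constant. -/
theorem IsEigenvalueBranch.ne_zero {c : OrthogonalCliffordModule 𝔷 𝔳} {U : Set (𝔷 × 𝔳)}
    {μ : 𝔷 × 𝔳 → ℝ} (hμ : c.IsEigenvalueBranch U μ) (hn : 5 ≤ finrank ℝ 𝔷)
    (hdim : 8 * (finrank ℝ 𝔷 : ℤ) - 28 < (finrank ℝ 𝔳 : ℤ)) (hUo : IsOpen U)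
    (hUc : IsPreconnected U) (hU : U ⊆ c.ramificationLocusᶜ) (hμ0 : ∃ X ∈ U, μ X ≠ 0) :
    ∀ X ∈ U, μ X ≠ 0 := by
  have hcont : ContinuousOn μ U := hμ.analytic.continuousOn
  have hopen₁ : IsOpen (U ∩ {X | μ X ≠ 0}) := hcont.isOpen_inter_preimage hUo isOpen_ne
  have hopen₂ : IsOpen (U ∩ {X | μ X = 0}) := by
    rw [isOpen_iff_mem_nhds]
    rintro X ⟨hXU, hX0⟩
    obtain ⟨ε, hε, hle⟩ := c.eventually_multiplicity_add_le (c.mem_domain (hU hXU))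
    have hsmall : ∀ᶠ Y in 𝓝 X, |μ Y| < ε := by
      refine ((hcont.continuousAt (hUo.mem_nhds hXU)).abs).eventually_lt_const ?_
      simpa [show μ X = 0 from hX0] using hε
    filter_upwards [hle, hsmall, hUo.mem_nhds hXU,
      c.eventually_multiplicity_zero_eq hn hdim (hU hXU)] with Y h1 h2 hYU h3
    refine ⟨hYU, ?_⟩
    by_contra hne
    have h4 := h1 _ hne h2
    have h5 := (c.multiplicity_pos_iff Y (μ Y)).mpr (hμ.hasEigenvalue Y hYU)
    omega
  have hsub := hUc.subset_left_of_subset_union hopen₁ hopen₂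
    (Set.disjoint_left.mpr fun X h1 h2 => h1.2 h2.2)
    (fun X hX => (em (μ X = 0)).elim (fun h => Or.inr ⟨hX, h⟩) fun h => Or.inl ⟨hX, h⟩)
    (hμ0.imp fun X h => ⟨h.1, h.1, h.2⟩)
  exact fun X hX => (hsub hX).2

end OrthogonalCliffordModule

end HType

end

theorem corollary4p6 {𝔷 𝔳 : Type*}
    [NormedAddCommGroup 𝔷] [InnerProductSpace ℝ 𝔷] [FiniteDimensional ℝ 𝔷]
    [NormedAddCommGroup 𝔳] [InnerProductSpace ℝ 𝔳] [FiniteDimensional ℝ 𝔳]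
    (c : HType.OrthogonalCliffordModule 𝔷 𝔳)
    (hn : 6 ≤ Module.finrank ℝ 𝔷)
    (hdim : 8 * (Module.finrank ℝ 𝔷 : ℤ) - 28 < (Module.finrank ℝ 𝔳 : ℤ))
    (X₀ : 𝔷 × 𝔳) (hX₀ : X₀ ∈ c.ramificationLocusᶜ)
    (U : Set (𝔷 × 𝔳)) (hU : U = connectedComponentIn c.ramificationLocusᶜ X₀)
    (μ : 𝔷 × 𝔳 → ℝ) (hμ : c.IsEigenvalueBranch U μ) (hμ0 : ∃ X ∈ U, μ X ≠ 0) :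
    ∀ X ∈ U, c.multiplicity X (μ X) = 2 := by
  intro X hX
  have hn' : 5 ≤ Module.finrank ℝ 𝔷 := by omega
  have hsub : U ⊆ c.ramificationLocusᶜ := hU ▸ connectedComponentIn_subset _ _
  have hopen : IsOpen U := hU ▸ c.isOpen_compl_ramificationLocus.connectedComponentIn
  have hconn : IsPreconnected U := hU ▸ isPreconnected_connectedComponentIn
  exact c.multiplicity_eq_two hn' hdim (hsub hX)
    (hμ.ne_zero hn' hdim hopen hconn hsub hμ0 X hX)
    ((c.multiplicity_pos_iff X (μ X)).mpr (hμ.hasEigenvalue X hX))
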